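/- Let $\rho$ be a measure on $\mathbb{R}$, let $\Theta=\{\theta\in\mathbb{R}:\int e^{\theta x}\,d\rho(x)<\infty\}$ be its natural parameter space, assumed to be open (the family is regular), let $b(\theta)=\log\int e^{\theta x}\,d\rho(x)$, and for $\theta\in\Theta$ let $\nu_\theta$ be the probability distribution with density $x\mapsto e^{x\theta-b(\theta)}$ with respect to $\rho$. Let $I=\dot b(\Theta)$ be the interval of the expectations of the $\nu_\theta$, let $\overline I=[\mu_-,\mu_+]$ be its closure in $[-\infty,+\infty]$, and for $\mu,\mu'\in I$ let $$d(\mu,\mu')=\mathrm{KL}\bigl(\nu_{\dot b^{-1}(\mu)},\nu_{\dot b^{-1}(\mu')}\bigr)=\bigl(\dot b^{-1}(\mu)-\dot b^{-1}(\mu')\bigr)\mu-b\bigl(\dot b^{-1}(\mu)\bigr)+b\bigl(\dot b^{-1}(\mu')\bigr),$$ extended by continuity in each variable, with values in $[0,+\infty]$, to $(\overline I\times I)\cup(I\times\overline I)$, with $d(\mu_\pm,\mu_\pm)=0$. Consider a bandit problem with $K$ arms whose distributions $\nu_1,\dots,\nu_K$ belong to $\{\nu_\theta:\theta\in\Theta\}$.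 At each round $t\ge1$ an arm $A_t$ is chosen on the basis of the past (and possibly of auxiliary randomization), and a payoff $Y_t$ is drawn from the distribution of that arm. Let $N_a(t)$ be the number of pulls of arm $a$ in rounds $1,\dots,t$, $\widehat\mu_a(t)$ the empirical mean of the payoffs received from arm $a$ in these rounds, $\mu_a$ the expectation of $\nu_a$, and $\mu^\star=\max_a\mu_a$. Suppose that the arms are chosen by kl-UCB: each arm is pulled once in rounds $1,\dots,K$, and for every $t\ge K$ the arm $A_{t+1}$ maximizes (ties being broken in any way) $$U_a(t)=\sup\Bigl\{\mu\in\overline I: d\bigl(\widehat\mu_a(t),\mu\bigr)\le\frac{f(t)}{N_a(t)}\Bigr\},$$ where $f(t)=\log t+3\log\log t$ for $t\ge3$ and $f(1)=f(2)=f(3)$. Then for every suboptimal arm $a$ (that is, $\mu_a<\mu^\star$) and every horizon $T\ge3$, $$\mathbb{E}[N_a(T)]\le\frac{\log T}{d(\mu_a,\mu^\star)}+2\sqrt{\frac{2\pi\,\sigma_{a,\star}^2\,\bigl(d'(\mu_a,\mu^\star)\bigr)^2}{\bigl(d(\mu_a,\mu^\star)\bigr)^3}}\,\sqrt{\log T+3\log\log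 T}+\Bigl(4e+\frac{3}{d(\mu_a,\mu^\star)}\Bigr)\log\log T+8\,\sigma_{a,\star}^2\Bigl(\frac{d'(\mu_a,\mu^\star)}{d(\mu_a,\mu^\star)}\Bigr)^2+6,$$ where $\sigma_{a,\star}^2=\max\{\mathrm{Var}(\nu_\theta):\theta\in\Theta,\ \mu_a\le\mathbb{E}(\nu_\theta)\le\mu^\star\}$ (the maximum is attained) and $d'(\cdot,\mu^\star)$ is the derivative of $d(\cdot,\mu^\star)$. -/

import Mathlib

open MeasureTheory ProbabilityTheory Set Filter Topology InformationTheory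
open scoped ENNReal

namespace KLUCB

noncomputable section

/-! ### Canonical one-parameter exponential families -/

/-- The natural parameter space `Θ = {θ | ∫ exp (θ x) dρ(x) < ∞}` of the dominating measure `ρ`. -/
def natParamSpace (ρ : Measure ℝ) : Set ℝ :=
  {θ | Integrable (fun x : ℝ => Real.exp (θ * x)) ρ}

/-- The log-partition function `b(θ) = log ∫ exp (θ x) dρ(x)`. -/
def logPartition (ρ : Measure ℝ) (θ : ℝ) : ℝ :=
  Real.log (∫ x, Real.exp (θ * x) ∂ρ)

/-- The member `ν_θ` of the family, with `ρ`-density `x ↦ exp (x θ - b(θ))`. -/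
def expFam (ρ : Measure ℝ) (θ : ℝ) : Measure ℝ :=
  ρ.withDensity fun x => ENNReal.ofReal (Real.exp (x * θ - logPartition ρ θ))

/-- The expectation of a distribution on `ℝ`. -/
def mean (ν : Measure ℝ) : ℝ := ∫ x, x ∂ν

/-- The set of expectations `I = b'(Θ)`. -/
def meanSpace (ρ : Measure ℝ) : Set ℝ := deriv (logPartition ρ) '' natParamSpace ρ

/-- The inverse of `b' : Θ → I`: the natural parameter with a given expectation. -/
def natParam (ρ : Measure ℝ) (m : ℝ) : ℝ :=
  Function.invFunOn (deriv (logPartition ρ)) (natParamSpace ρ) m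

/-- The divergence `d(m, m')` for `m, m' ∈ I`: the Kullback-Leibler divergence between the members
of the family with expectations `m` and `m'`. -/
def klMean (ρ : Measure ℝ) (m m' : ℝ) : ℝ≥0∞ :=
  klDiv (expFam ρ (natParam ρ m)) (expFam ρ (natParam ρ m'))

/-- `I` as a set of extended reals. -/
def meanSpaceE (ρ : Measure ℝ) : Set EReal := Real.toEReal '' meanSpace ρ

/-- The closure `[μ₋, μ₊]` of `I` in the extended reals. -/
def meanClosure (ρ : Measure ℝ) : Set EReal := closure (meanSpaceE ρ)

/-- Approach to an extended real `x` through real points of `I`. -/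
def approach (ρ : Measure ℝ) (x : EReal) : Filter ℝ :=
  comap Real.toEReal (𝓝 x) ⊓ 𝓟 (meanSpace ρ)

open Classical in
/-- The divergence extended by continuity, in one variable at a time, to pairs of points of
`[μ₋, μ₊]` one of which lies in `I`, and by `d(μ₋, μ₋) = d(μ₊, μ₊) = 0`. Other pairs of distinct
points get the value `∞`, so they never satisfy a bound on the divergence. -/
def klExt (ρ : Measure ℝ) (x y : EReal) : ℝ≥0∞ :=
  if x = y then 0
  else if x ∈ meanSpaceE ρ ∧ y ∈ meanSpaceE ρ then klMean ρ x.toReal y.toReal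
  else if x ∈ meanClosure ρ ∧ y ∈ meanSpaceE ρ then
    limUnder (approach ρ x) fun m => klMean ρ m y.toReal
  else if x ∈ meanSpaceE ρ ∧ y ∈ meanClosure ρ then
    limUnder (approach ρ y) fun m => klMean ρ x.toReal m
  else ∞

/-! ### The bandit game -/

section Bandit

variable {Ω : Type*} {K : ℕ}

/-- `N_a(t)`: the number of rounds `s ∈ {1, …, t}` at which arm `a` is pulled. -/
def pulls (A : ℕ → Ω → Fin K) (a : Fin K) (t : ℕ) (ω : Ω) : ℕ :=
  ((Finset.Icc 1 t).filter fun s => A s ω = a).card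

/-- The empirical mean of the payoffs of arm `a` after round `t`. -/
def empMean (A : ℕ → Ω → Fin K) (Y : ℕ → Ω → ℝ) (a : Fin K) (t : ℕ) (ω : Ω) : ℝ :=
  (∑ s ∈ Finset.Icc 1 t, if A s ω = a then Y s ω else 0) / (pulls A a t ω : ℝ)

/-- The sequential game: rounds are `1, 2, …`, and `ℱ t` is the information available after
round `t`, which contains `A_1, Y_1, …, A_t, Y_t` and possibly auxiliary randomization. The arm of
round `t + 1` is chosen on the basis of `ℱ t`, and then the payoff of round `t + 1` is drawn from
the distribution of that arm. -/
structure IsBanditRun [mΩ : MeasurableSpace Ω] (P : Measure Ω) (ℱ : Filtration ℕ mΩ)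
    (ν : Fin K → Measure ℝ) (A : ℕ → Ω → Fin K) (Y : ℕ → Ω → ℝ) : Prop where
  measurable_arm : ∀ t, Measurable[ℱ t] (A (t + 1))
  measurable_payoff : ∀ t, Measurable[ℱ (t + 1)] (Y (t + 1))
  payoff_law : ∀ t, ∀ B : Set ℝ, MeasurableSet B →
    P[(Y (t + 1) ⁻¹' B).indicator (fun _ => (1 : ℝ)) | ℱ t]
      =ᵐ[P] fun ω => (ν (A (t + 1) ω)).real B

/-- The upper confidence bound
`U_a(t) = sup {m ∈ [μ₋, μ₊] | d(empirical mean of a, m) ≤ f(t) / N_a(t)}`. -/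
def ucbIndex (ρ : Measure ℝ) (f : ℕ → ℝ) (A : ℕ → Ω → Fin K) (Y : ℕ → Ω → ℝ)
    (a : Fin K) (t : ℕ) (ω : Ω) : EReal :=
  sSup {m : EReal | m ∈ meanClosure ρ ∧
    klExt ρ (empMean A Y a t ω : EReal) m ≤ ENNReal.ofReal (f t / (pulls A a t ω : ℝ))}

/-- The arms are chosen by kl-UCB with exploration function `f`: each arm is pulled once during the
first `K` rounds, and from then on an arm with the largest upper confidence bound is pulled (ties
are broken in any way). -/
structure IsKlUCB [MeasurableSpace Ω] (P : Measure Ω) (ρ : Measure ℝ) (f : ℕ → ℝ)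
    (A : ℕ → Ω → Fin K) (Y : ℕ → Ω → ℝ) : Prop where
  init : ∀ᵐ ω ∂P, ∀ a, pulls A a K ω = 1
  argmax : ∀ᵐ ω ∂P, ∀ t, K ≤ t → ∀ a,
    ucbIndex ρ f A Y a t ω ≤ ucbIndex ρ f A Y (A (t + 1) ω) t ω

end Bandit

/-- `f(t) = log t + 3 log log t` for `t ≥ 3`, and `f(t) = f(3)` for `t < 3`. -/
def explorationRate (t : ℕ) : ℝ :=
  Real.log (max t 3 : ℕ) + 3 * Real.log (Real.log (max t 3 : ℕ))

/-! ### Explicit form of the divergence -/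

theorem expFam_eq_tilted {ρ : Measure ℝ} [NeZero ρ] {θ : ℝ} (hθ : θ ∈ natParamSpace ρ) :
    expFam ρ θ = ρ.tilted (fun x => θ * x) := by
  have hpos : 0 < ∫ x, Real.exp (θ * x) ∂ρ := integral_exp_pos hθ
  unfold expFam Measure.tilted logPartition
  congr 1
  ext x
  rw [Real.exp_sub, Real.exp_log hpos, mul_comm x θ]

theorem sigmaFinite_of_mem {ρ : Measure ℝ} {θ : ℝ} (hθ : θ ∈ natParamSpace ρ) :
    SigmaFinite ρ := by
  have hm : Measurable fun x : ℝ => ENNReal.ofReal (Real.exp (θ * x)) := by fun_prop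
  have hfin : IsFiniteMeasure (ρ.withDensity fun x => ENNReal.ofReal (Real.exp (θ * x))) :=
    isFiniteMeasure_withDensity_ofReal (Integrable.hasFiniteIntegral hθ)
  rw [← withDensity_inv_same (μ := ρ) hm (ae_of_all _ fun x => by simp [Real.exp_pos])
    (ae_of_all _ fun x => by simp)]
  exact SigmaFinite.withDensity_of_ne_top (ae_of_all _ fun x => by simp [Real.exp_pos])

/-- `KL(ν_θ, ν_θ') = (θ - θ') b'(θ) - b(θ) + b(θ')`; in particular it is finite. -/
theorem klDiv_expFam {ρ : Measure ℝ} [NeZero ρ] (hreg : IsOpen (natParamSpace ρ)) {θ θ' : ℝ}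
    (hθ : θ ∈ natParamSpace ρ) (hθ' : θ' ∈ natParamSpace ρ) :
    klDiv (expFam ρ θ) (expFam ρ θ') = ENNReal.ofReal
      ((θ - θ') * deriv (logPartition ρ) θ - logPartition ρ θ + logPartition ρ θ') := by
  have hc : logPartition ρ = cgf id ρ := rfl
  have hset : natParamSpace ρ = integrableExpSet id ρ := rfl
  have hint : θ ∈ interior (integrableExpSet id ρ) := by rwa [← hset, hreg.interior_eq]
  have := sigmaFinite_of_mem hθ
  have hP : IsProbabilityMeasure (expFam ρ θ) := by
    rw [expFam_eq_tilted hθ]; exact isProbabilityMeasure_tilted hθ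
  have hP' : IsProbabilityMeasure (expFam ρ θ') := by
    rw [expFam_eq_tilted hθ']; exact isProbabilityMeasure_tilted hθ'
  have hac : expFam ρ θ ≪ ρ := withDensity_absolutelyContinuous _ _
  have hac2 : ρ ≪ expFam ρ θ' := by
    rw [expFam_eq_tilted hθ']; exact absolutelyContinuous_tilted hθ'
  have hmean : ∫ x, x ∂(expFam ρ θ) = deriv (logPartition ρ) θ := by
    rw [expFam_eq_tilted hθ, hc]; exact integral_tilted_mul_self hint
  have hintx : Integrable (fun x : ℝ => x) (expFam ρ θ) := by
    rw [expFam_eq_tilted hθ]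
    exact (memLp_tilted_mul hint 1).integrable (by simp)
  have hllr : llr (expFam ρ θ) (expFam ρ θ') =ᵐ[expFam ρ θ]
      fun x => (θ - θ') * x - logPartition ρ θ + logPartition ρ θ' := by
    have h1 : llr (expFam ρ θ) (expFam ρ θ') =ᵐ[expFam ρ θ] fun x =>
        -(θ' * x) + Real.log (∫ z, Real.exp (θ' * z) ∂ρ) + llr (expFam ρ θ) ρ x := by
      conv_lhs => rw [expFam_eq_tilted hθ']
      exact llr_tilted_right (f := fun x => θ' * x) hac hθ'
    have h2 : llr (expFam ρ θ) ρ =ᵐ[ρ] fun x =>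
        θ * x - Real.log (∫ z, Real.exp (θ * z) ∂ρ) + llr ρ ρ x := by
      conv_lhs => rw [expFam_eq_tilted hθ]
      exact llr_tilted_left (f := fun x => θ * x) Measure.AbsolutelyContinuous.rfl hθ (by fun_prop)
    filter_upwards [h1, hac.ae_le h2, hac.ae_le (llr_self ρ)] with x e1 e2 e3
    rw [e1, e2, e3]
    simp only [logPartition, Pi.zero_apply]
    ring
  have hI : Integrable (fun x : ℝ => (θ - θ') * x - logPartition ρ θ + logPartition ρ θ')
      (expFam ρ θ) := ((hintx.const_mul _).sub (integrable_const _)).add (integrable_const _)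
  rw [klDiv_of_ac_of_integrable (hac.trans hac2) (hI.congr hllr.symm), integral_congr_ae hllr,
    show (∫ x, ((θ - θ') * x - logPartition ρ θ + logPartition ρ θ') ∂(expFam ρ θ)) =
      (θ - θ') * deriv (logPartition ρ) θ - logPartition ρ θ + logPartition ρ θ' by
      have h1 : Integrable (fun x : ℝ => (θ - θ') * x) (expFam ρ θ) := hintx.const_mul _
      have h2 : Integrable (fun x : ℝ => (θ - θ') * x - logPartition ρ θ) (expFam ρ θ) :=
        h1.sub (integrable_const _)
      rw [integral_add h2 (integrable_const _),
        integral_sub h1 (integrable_const _), integral_const_mul, hmean]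
      simp]
  simp

end

end KLUCB

/-! The likelihood ratio `logLik ρ θ θ' x` is affine in the observation `x`, and the divergence from
mean `x` to the mean of `θ'` is its maximum over `θ`, attained where `b'(θ) = x`. The confidence
bounds use the divergence extended to the boundary of the mean space. `logLik_le_klExt` and
`exists_lt_logLik_of_lt_klExt` turn bounds on that extension into bounds on likelihood ratios at the
empirical mean. The second needs empirical means in the closure of the mean space, hence the study
of the support of `ρ`.

If the suboptimal arm `a` is pulled after the initialization, then either the index of the best arm
is below its mean, or the index of `a` is at least the mean of the best arm.
`pulls_le_sum_indicator` charges the first event to the round and the second to the current number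
of pulls of `a`.

Both events are controlled by a change of measure: the product of the factors `exp (logLik η θ Y)`
over the pulls of one arm has expectation 1 (`IsBanditRun.lintegral_likelihood`), so Markov's
inequality gives Chernoff bounds despite the adaptive sampling. In the first event the number of
pulls and the witness `η` are random. Peeling over geometric slices
(`IsBanditRun.measure_lt_pulls_mul_logLik`) costs a factor `⌈f(t) log t⌉`, and the `3 log log t` in
`f` makes the resulting series grow only like `log log T`.

In the second event, `n` pulls of `a` satisfy `logLik ≤ f(T) / n` at the empirical mean, which for
`n > F = f(T) / d` is a large deviation. Bounding `b''` by the maximal variance gives the tail of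
`IsBanditRun.measure_logLik_le_le`, and `sum_range_le_of_chernoff` sums it to `F` plus terms of
order `√F` and 1. -/

namespace KLUCB

/-! ### Analysis of the exponential family -/

section Family

variable {ρ : Measure ℝ}

theorem mem_interior_integrableExpSet (hreg : IsOpen (natParamSpace ρ)) {θ : ℝ}
    (hθ : θ ∈ natParamSpace ρ) : θ ∈ interior (integrableExpSet id ρ) := by
  have hset : natParamSpace ρ = integrableExpSet id ρ := rfl
  rwa [← hset, hreg.interior_eq]

theorem convex_natParamSpace : Convex ℝ (natParamSpace ρ) :=
  convex_integrableExpSet (X := id) (μ := ρ)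

theorem Icc_subset_natParamSpace {θ θ' : ℝ} (hθ : θ ∈ natParamSpace ρ)
    (hθ' : θ' ∈ natParamSpace ρ) : Icc θ θ' ⊆ natParamSpace ρ :=
  convex_natParamSpace.ordConnected.out hθ hθ'

theorem analyticAt_logPartition (hreg : IsOpen (natParamSpace ρ)) {θ : ℝ}
    (hθ : θ ∈ natParamSpace ρ) : AnalyticAt ℝ (logPartition ρ) θ :=
  analyticAt_cgf (X := id) (μ := ρ) (mem_interior_integrableExpSet hreg hθ)

theorem hasDerivAt_logPartition (hreg : IsOpen (natParamSpace ρ)) {θ : ℝ}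
    (hθ : θ ∈ natParamSpace ρ) :
    HasDerivAt (logPartition ρ) (deriv (logPartition ρ) θ) θ :=
  (analyticAt_logPartition hreg hθ).differentiableAt.hasDerivAt

theorem hasDerivAt_deriv_logPartition (hreg : IsOpen (natParamSpace ρ)) {θ : ℝ}
    (hθ : θ ∈ natParamSpace ρ) :
    HasDerivAt (deriv (logPartition ρ)) (deriv (deriv (logPartition ρ)) θ) θ :=
  (analyticAt_logPartition hreg hθ).deriv.differentiableAt.hasDerivAt

theorem continuousOn_deriv_logPartition (hreg : IsOpen (natParamSpace ρ)) :
    ContinuousOn (deriv (logPartition ρ)) (natParamSpace ρ) := fun _ hθ =>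
  (hasDerivAt_deriv_logPartition hreg hθ).continuousAt.continuousWithinAt

theorem continuousOn_logPartition (hreg : IsOpen (natParamSpace ρ)) :
    ContinuousOn (logPartition ρ) (natParamSpace ρ) := fun _ hθ =>
  (hasDerivAt_logPartition hreg hθ).continuousAt.continuousWithinAt

theorem mean_expFam [NeZero ρ] (hreg : IsOpen (natParamSpace ρ)) {θ : ℝ}
    (hθ : θ ∈ natParamSpace ρ) : mean (expFam ρ θ) = deriv (logPartition ρ) θ := by
  rw [mean, expFam_eq_tilted hθ]
  exact integral_tilted_mul_self (X := id) (mem_interior_integrableExpSet hreg hθ)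

theorem variance_expFam [NeZero ρ] (hreg : IsOpen (natParamSpace ρ)) {θ : ℝ}
    (hθ : θ ∈ natParamSpace ρ) :
    variance id (expFam ρ θ) = deriv (deriv (logPartition ρ)) θ := by
  rw [expFam_eq_tilted hθ]
  have h := variance_tilted_mul (X := id) (mem_interior_integrableExpSet hreg hθ)
  rw [iteratedDeriv_succ, iteratedDeriv_one] at h
  exact h

theorem isProbabilityMeasure_expFam [NeZero ρ] {θ : ℝ} (hθ : θ ∈ natParamSpace ρ) :
    IsProbabilityMeasure (expFam ρ θ) := by
  rw [expFam_eq_tilted hθ]; exact isProbabilityMeasure_tilted hθ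

theorem expFam_absolutelyContinuous (θ : ℝ) : expFam ρ θ ≪ ρ :=
  withDensity_absolutelyContinuous _ _

theorem absolutelyContinuous_expFam [NeZero ρ] {θ : ℝ} (hθ : θ ∈ natParamSpace ρ) :
    ρ ≪ expFam ρ θ := by
  rw [expFam_eq_tilted hθ]; exact absolutelyContinuous_tilted hθ

theorem deriv_deriv_logPartition_nonneg [NeZero ρ] (hreg : IsOpen (natParamSpace ρ)) {θ : ℝ}
    (hθ : θ ∈ natParamSpace ρ) : 0 ≤ deriv (deriv (logPartition ρ)) θ := by
  rw [← variance_expFam hreg hθ]; exact variance_nonneg _ _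

/-- A vanishing variance at one parameter would make the identity constant `ρ`-almost everywhere,
because all members of the family are equivalent to `ρ`. All means would then coincide. -/
theorem deriv_deriv_logPartition_pos [NeZero ρ] (hreg : IsOpen (natParamSpace ρ))
    {θ₁ θ₂ : ℝ} (h₁ : θ₁ ∈ natParamSpace ρ) (h₂ : θ₂ ∈ natParamSpace ρ)
    (hne : deriv (logPartition ρ) θ₁ ≠ deriv (logPartition ρ) θ₂) {θ : ℝ}
    (hθ : θ ∈ natParamSpace ρ) : 0 < deriv (deriv (logPartition ρ)) θ := by
  refine (deriv_deriv_logPartition_nonneg hreg hθ).lt_of_ne' fun h0 => hne ?_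
  have := isProbabilityMeasure_expFam hθ
  rw [← variance_expFam hreg hθ] at h0
  have hL : MemLp id 2 (expFam ρ θ) := by
    rw [expFam_eq_tilted hθ]
    exact memLp_tilted_mul (X := id) (mem_interior_integrableExpSet hreg hθ) 2
  have hae := (absolutelyContinuous_expFam hθ).ae_le (ae_eq_integral_of_variance_eq_zero hL h0)
  have key : ∀ η ∈ natParamSpace ρ, deriv (logPartition ρ) η = ∫ x, id x ∂(expFam ρ θ) := by
    intro η hη
    have := isProbabilityMeasure_expFam hη
    have hη_ae : (fun x : ℝ => x) =ᵐ[expFam ρ η] fun _ => ∫ x, id x ∂(expFam ρ θ) :=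
      (expFam_absolutelyContinuous (ρ := ρ) η).ae_le hae
    rw [← mean_expFam hreg hη, mean, integral_congr_ae hη_ae, integral_const]
    simp
  rw [key _ h₁, key _ h₂]

theorem strictMonoOn_deriv_logPartition (hreg : IsOpen (natParamSpace ρ))
    (hpos : ∀ θ ∈ natParamSpace ρ, 0 < deriv (deriv (logPartition ρ)) θ) :
    StrictMonoOn (deriv (logPartition ρ)) (natParamSpace ρ) :=
  strictMonoOn_of_deriv_pos convex_natParamSpace (continuousOn_deriv_logPartition hreg)
    fun θ hθ => hpos θ (interior_subset hθ)

theorem monotoneOn_deriv_logPartition [NeZero ρ] (hreg : IsOpen (natParamSpace ρ)) :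
    MonotoneOn (deriv (logPartition ρ)) (natParamSpace ρ) :=
  monotoneOn_of_deriv_nonneg convex_natParamSpace (continuousOn_deriv_logPartition hreg)
    (fun _ hθ => (hasDerivAt_deriv_logPartition hreg
      (interior_subset hθ)).differentiableAt.differentiableWithinAt)
    fun _ hθ => deriv_deriv_logPartition_nonneg hreg (interior_subset hθ)

theorem logPartition_tangent_le [NeZero ρ] (hreg : IsOpen (natParamSpace ρ)) {θ θ' : ℝ}
    (hθ : θ ∈ natParamSpace ρ) (hθ' : θ' ∈ natParamSpace ρ) :
    logPartition ρ θ + deriv (logPartition ρ) θ * (θ' - θ) ≤ logPartition ρ θ' := by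
  have hconv : ConvexOn ℝ (natParamSpace ρ) (logPartition ρ) := by
    refine MonotoneOn.convexOn_of_deriv convex_natParamSpace (continuousOn_logPartition hreg)
      (fun _ h => (hasDerivAt_logPartition hreg
        (interior_subset h)).differentiableAt.differentiableWithinAt) ?_
    exact (monotoneOn_deriv_logPartition hreg).mono interior_subset
  have hd := (hasDerivAt_logPartition hreg hθ).differentiableAt
  rcases lt_trichotomy θ θ' with h | rfl | h
  · have := hconv.deriv_le_slope hθ hθ' h hd
    rw [slope_def_field, le_div_iff₀ (by linarith)] at this
    linarith
  · simp
  · have := hconv.slope_le_deriv hθ' hθ h hd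
    rw [slope_def_field, div_le_iff₀ (by linarith)] at this
    linarith

/-- The log-likelihood ratio between the parameters `θ` and `θ'` at `x`. -/
noncomputable def logLik (ρ : Measure ℝ) (θ θ' x : ℝ) : ℝ :=
  (θ - θ') * x - logPartition ρ θ + logPartition ρ θ'

/-- Maximum likelihood: the parameter whose mean is the observation maximizes the likelihood, since
`b` lies above its tangent there. -/
theorem logLik_le_logLik_mean [NeZero ρ] (hreg : IsOpen (natParamSpace ρ)) {θ η : ℝ} (η' : ℝ)
    (hθ : θ ∈ natParamSpace ρ) (hη : η ∈ natParamSpace ρ) :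
    logLik ρ θ η' (deriv (logPartition ρ) η) ≤ logLik ρ η η' (deriv (logPartition ρ) η) := by
  have := logPartition_tangent_le hreg hη hθ
  unfold logLik
  linarith

theorem logLik_mono_right [NeZero ρ] (hreg : IsOpen (natParamSpace ρ)) (θ : ℝ) {η η' x : ℝ}
    (hη : η ∈ natParamSpace ρ) (hη' : η' ∈ natParamSpace ρ) (hle : η ≤ η')
    (hx : x ≤ deriv (logPartition ρ) η) : logLik ρ θ η x ≤ logLik ρ θ η' x := by
  have := logPartition_tangent_le hreg hη hη'
  have h2 := mul_le_mul_of_nonneg_right hx (sub_nonneg.2 hle)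
  unfold logLik
  linarith

theorem logLik_nonpos [NeZero ρ] (hreg : IsOpen (natParamSpace ρ)) {θ η x : ℝ}
    (hθ : θ ∈ natParamSpace ρ) (hη : η ∈ natParamSpace ρ) (hle : θ ≤ η)
    (hx : deriv (logPartition ρ) η ≤ x) : logLik ρ θ η x ≤ 0 := by
  have := logPartition_tangent_le hreg hη hθ
  have h2 := mul_le_mul_of_nonneg_right hx (sub_nonneg.2 hle)
  unfold logLik
  linarith

theorem logLik_anti {θ η x y : ℝ} (hle : θ ≤ η) (hxy : x ≤ y) :
    logLik ρ θ η y ≤ logLik ρ θ η x := by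
  have h2 := mul_le_mul_of_nonneg_right hxy (sub_nonneg.2 hle)
  unfold logLik
  linarith

theorem continuous_logLik (θ η : ℝ) : Continuous (logLik ρ θ η) := by
  unfold logLik; fun_prop

theorem natParam_mem {m : ℝ} (hm : m ∈ meanSpace ρ) : natParam ρ m ∈ natParamSpace ρ :=
  Function.invFunOn_mem hm

theorem deriv_logPartition_natParam {m : ℝ} (hm : m ∈ meanSpace ρ) :
    deriv (logPartition ρ) (natParam ρ m) = m :=
  Function.invFunOn_eq hm

theorem natParam_deriv_logPartition
    (hmono : StrictMonoOn (deriv (logPartition ρ)) (natParamSpace ρ)) {θ : ℝ}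
    (hθ : θ ∈ natParamSpace ρ) : natParam ρ (deriv (logPartition ρ) θ) = θ :=
  hmono.injOn.leftInvOn_invFunOn hθ

theorem klMean_eq_logLik [NeZero ρ] (hreg : IsOpen (natParamSpace ρ)) {m m' : ℝ}
    (hm : m ∈ meanSpace ρ) (hm' : m' ∈ meanSpace ρ) :
    klMean ρ m m' = ENNReal.ofReal (logLik ρ (natParam ρ m) (natParam ρ m') m) := by
  rw [klMean, klDiv_expFam hreg (natParam_mem hm) (natParam_mem hm'),
    deriv_logPartition_natParam hm, logLik]

theorem logLik_mean_nonneg [NeZero ρ] (hreg : IsOpen (natParamSpace ρ)) {θ θ' : ℝ}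
    (hθ : θ ∈ natParamSpace ρ) (hθ' : θ' ∈ natParamSpace ρ) :
    0 ≤ logLik ρ θ θ' (deriv (logPartition ρ) θ) := by
  have := logPartition_tangent_le hreg hθ hθ'
  unfold logLik
  linarith

theorem natParam_mono
    (hmono : StrictMonoOn (deriv (logPartition ρ)) (natParamSpace ρ)) {m m' : ℝ}
    (hm : m ∈ meanSpace ρ) (hm' : m' ∈ meanSpace ρ) (hle : m ≤ m') :
    natParam ρ m ≤ natParam ρ m' := by
  rwa [← hmono.le_iff_le (natParam_mem hm) (natParam_mem hm'), deriv_logPartition_natParam hm,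
    deriv_logPartition_natParam hm']

theorem ordConnected_meanSpace (hreg : IsOpen (natParamSpace ρ)) :
    (meanSpace ρ).OrdConnected :=
  (convex_natParamSpace.isPreconnected.image _
    (continuousOn_deriv_logPartition hreg)).ordConnected

/-- Second order upper bound on the log-partition function. -/
theorem logPartition_le_quadratic (hreg : IsOpen (natParamSpace ρ)) {θ θ' v : ℝ}
    (hθ : θ ∈ natParamSpace ρ) (hθ' : θ' ∈ natParamSpace ρ) (hle : θ ≤ θ')
    (hv : ∀ η ∈ Icc θ θ', deriv (deriv (logPartition ρ)) η ≤ v) :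
    logPartition ρ θ' ≤
      logPartition ρ θ + deriv (logPartition ρ) θ * (θ' - θ) + v * (θ' - θ) ^ 2 / 2 := by
  have hsub := Icc_subset_natParamSpace hθ hθ'
  have hd : ∀ η ∈ Icc θ θ',
      deriv (logPartition ρ) η ≤ deriv (logPartition ρ) θ + v * (η - θ) := by
    intro η hη
    have := (convex_Icc θ θ').image_sub_le_mul_sub_of_deriv_le
      ((continuousOn_deriv_logPartition hreg).mono hsub)
      (fun x hx => (hasDerivAt_deriv_logPartition hreg
        (hsub (interior_subset hx))).differentiableAt.differentiableWithinAt)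
      (fun x hx => hv x (interior_subset hx)) θ ⟨le_rfl, hle⟩ η hη hη.1
    linarith
  have hg : ∀ η ∈ Icc θ θ', HasDerivAt (fun η => logPartition ρ η -
      deriv (logPartition ρ) θ * (η - θ) - v * (η - θ) ^ 2 / 2)
      (deriv (logPartition ρ) η - deriv (logPartition ρ) θ - v * (η - θ)) η := by
    intro η hη
    have h1 := hasDerivAt_logPartition hreg (hsub hη)
    have h2 := ((hasDerivAt_id η).sub_const θ).const_mul (deriv (logPartition ρ) θ)
    have h3 := ((((hasDerivAt_id η).sub_const θ).pow 2).const_mul v).div_const 2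
    refine ((h1.sub h2).sub h3).congr_deriv ?_
    simp
    ring
  have := (convex_Icc θ θ').image_sub_le_mul_sub_of_deriv_le (C := 0)
      (fun x hx => (hg x hx).continuousAt.continuousWithinAt)
      (fun x hx => (hg x (interior_subset hx)).differentiableAt.differentiableWithinAt)
      (fun x hx => by
        rw [(hg x (interior_subset hx)).deriv]
        linarith [hd x (interior_subset hx)]) θ ⟨le_rfl, hle⟩ θ' ⟨hle, le_rfl⟩ hle
  simp at this
  linarith

/-- Strict monotonicity of `b'` turns the constraint on means into a compact interval of parameters,
on which the continuous `b''` attains its maximum. The last component of the conclusion serves to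
prove that the maximum is positive. -/
theorem isGreatest_variance [NeZero ρ] (hreg : IsOpen (natParamSpace ρ))
    (hmono : StrictMonoOn (deriv (logPartition ρ)) (natParamSpace ρ)) {θ θ' : ℝ}
    (hθ : θ ∈ natParamSpace ρ) (hθ' : θ' ∈ natParamSpace ρ) (hle : θ ≤ θ') :
    ∃ v, IsGreatest {v : ℝ | ∃ η ∈ natParamSpace ρ,
        deriv (logPartition ρ) θ ≤ mean (expFam ρ η) ∧
        mean (expFam ρ η) ≤ deriv (logPartition ρ) θ' ∧ v = variance id (expFam ρ η)} v ∧
      (∀ η ∈ Icc θ θ', deriv (deriv (logPartition ρ)) η ≤ v) ∧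
      ∃ η ∈ natParamSpace ρ, v = deriv (deriv (logPartition ρ)) η := by
  have hsub := Icc_subset_natParamSpace hθ hθ'
  obtain ⟨η, hη, hmax⟩ := isCompact_Icc.exists_isMaxOn (nonempty_Icc.2 hle)
    (f := deriv (deriv (logPartition ρ))) fun x hx =>
      (analyticAt_logPartition hreg (hsub hx)).deriv.deriv.continuousAt.continuousWithinAt
  refine ⟨deriv (deriv (logPartition ρ)) η, ⟨⟨η, hsub hη, ?_, ?_, ?_⟩, ?_⟩, hmax,
    η, hsub hη, rfl⟩
  · rw [mean_expFam hreg (hsub hη)]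
    exact (hmono.le_iff_le hθ (hsub hη)).2 hη.1
  · rw [mean_expFam hreg (hsub hη)]
    exact (hmono.le_iff_le (hsub hη) hθ').2 hη.2
  · rw [variance_expFam hreg (hsub hη)]
  · rintro v ⟨ζ, hζ, h1, h2, rfl⟩
    rw [mean_expFam hreg hζ] at h1 h2
    rw [variance_expFam hreg hζ]
    exact hmax ⟨(hmono.le_iff_le hθ hζ).1 h1, (hmono.le_iff_le hζ hθ').1 h2⟩

/-- The derivative of the divergence in its first variable is the difference of the natural
parameters. -/
theorem hasDerivAt_klMean_left [NeZero ρ] (hreg : IsOpen (natParamSpace ρ))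
    (hpos : ∀ θ ∈ natParamSpace ρ, 0 < deriv (deriv (logPartition ρ)) θ) {θ θ' : ℝ}
    (hθ : θ ∈ natParamSpace ρ) (hθ' : θ' ∈ natParamSpace ρ) :
    HasDerivAt (fun m => (klMean ρ m (deriv (logPartition ρ) θ')).toReal) (θ - θ')
      (deriv (logPartition ρ) θ) := by
  have hmono := strictMonoOn_deriv_logPartition hreg hpos
  set β := deriv (logPartition ρ) with hβ
  have hs : HasStrictDerivAt β (deriv β θ) θ :=
    (analyticAt_logPartition hreg hθ).deriv.hasStrictDerivAt
  have hne : deriv β θ ≠ 0 := (hpos θ hθ).ne'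
  set g := hs.localInverse β _ θ hne
  have hg : HasDerivAt g (deriv β θ)⁻¹ (β θ) := (hs.to_localInverse hne).hasDerivAt
  have hgθ : g (β θ) = θ := (hs.eventually_left_inverse hne).self_of_nhds
  have hgmem : ∀ᶠ m in 𝓝 (β θ), g m ∈ natParamSpace ρ :=
    hg.continuousAt.eventually_mem (hgθ.symm ▸ hreg.mem_nhds hθ)
  have hev : (fun m => (klMean ρ m (β θ')).toReal) =ᶠ[𝓝 (β θ)]
      fun m => (g m - θ') * m - logPartition ρ (g m) + logPartition ρ θ' := by
    filter_upwards [hgmem, hs.eventually_right_inverse hne] with m hm hbm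
    have hbm' : β (g m) = m := hbm
    have h1 : natParam ρ m = g m := by
      conv_lhs => rw [← hbm']
      exact natParam_deriv_logPartition hmono hm
    have hmI : m ∈ meanSpace ρ := ⟨g m, hm, hbm'⟩
    rw [klMean_eq_logLik hreg hmI ⟨θ', hθ', rfl⟩, h1, natParam_deriv_logPartition hmono hθ']
    rw [ENNReal.toReal_ofReal, logLik]
    have := logLik_mean_nonneg hreg hm hθ'
    rwa [← hβ, hbm'] at this
  have hb : HasDerivAt (logPartition ρ) (β θ) (g (β θ)) := by
    rw [hgθ]; exact hasDerivAt_logPartition hreg hθ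
  have := (((hg.sub_const θ').mul (hasDerivAt_id (β θ))).sub (hb.comp (β θ) hg)).add_const
    (logPartition ρ θ')
  -- The two terms containing the derivative of `g` cancel, because `b'(g m) = m`.
  refine (this.congr_of_eventuallyEq hev).congr_deriv ?_
  rw [hgθ]
  simp
  ring

end Family

/-! ### The support of the family -/

section Support

variable {ρ : Measure ℝ}

/-- If the mean is bounded by `c` in the direction `ε`, so is the support of `ρ`. -/
theorem measure_direction_gt_eq_zero [NeZero ρ] (hreg : IsOpen (natParamSpace ρ)) {ε c θ₀ : ℝ}
    (hθ₀ : θ₀ ∈ natParamSpace ρ)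
    (hc : ∀ θ ∈ natParamSpace ρ, ε * deriv (logPartition ρ) θ ≤ c) :
    ρ {x | c < ε * x} = 0 := by
  set Z : ℝ≥0∞ := ENNReal.ofReal (Real.exp (logPartition ρ θ₀))
  have hZ : Z ≠ ∞ := ENNReal.ofReal_ne_top
  -- Moving the parameter by `ε * s` and discounting by `c * s` makes the mass of `F s`
  -- nonincreasing in `s`, by the bound on the mean, whereas `F s x` explodes as `s → ∞` wherever `c
  -- < ε * x`.
  let F : ℝ → ℝ → ℝ≥0∞ := fun s x => ENNReal.ofReal (Real.exp ((θ₀ + ε * s) * x - c * s))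
  have hF : ∀ s, Measurable (F s) := fun s => by
    show Measurable fun x : ℝ => ENNReal.ofReal (Real.exp ((θ₀ + ε * s) * x - c * s))
    fun_prop
  have hFc : ∀ x, Continuous fun s => F s x := fun x => by
    show Continuous fun s : ℝ => ENNReal.ofReal (Real.exp ((θ₀ + ε * s) * x - c * s))
    exact ENNReal.continuous_ofReal.comp (by fun_prop)
  have hexp : ∀ s x, Real.exp ((θ₀ + ε * s) * x - c * s) =
      Real.exp ((θ₀ + ε * s) * x) * Real.exp (-(c * s)) := fun s x => by
    rw [← Real.exp_add]; ring_nf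
  have hmemF : ∀ s, ∫⁻ x, F s x ∂ρ ≤ Z → θ₀ + ε * s ∈ natParamSpace ρ := by
    intro s hs
    have h1 : Integrable (fun x => Real.exp ((θ₀ + ε * s) * x - c * s)) ρ := by
      refine ⟨by fun_prop, ?_⟩
      rw [hasFiniteIntegral_iff_ofReal (ae_of_all _ fun x => (Real.exp_pos _).le)]
      exact hs.trans_lt hZ.lt_top
    simp_rw [hexp] at h1
    exact (integrable_mul_const_iff (Real.exp_pos _).ne'.isUnit _).1 h1
  have hFmem : ∀ s, 0 ≤ s → θ₀ + ε * s ∈ natParamSpace ρ → ∫⁻ x, F s x ∂ρ ≤ Z := by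
    intro s hs hmem
    have hseg : ∀ u ∈ Icc 0 s, θ₀ + ε * u ∈ natParamSpace ρ := by
      intro u hu
      rcases hs.eq_or_lt with rfl | hs
      · obtain rfl : u = 0 := le_antisymm hu.2 hu.1
        exact hmem
      have h := convex_natParamSpace hθ₀ hmem (a := 1 - u / s) (b := u / s)
        (sub_nonneg.2 ((div_le_one hs).2 hu.2)) (div_nonneg hu.1 hs.le) (by ring)
      convert h using 1
      simp only [smul_eq_mul]
      field_simp
      ring
    have hd : ∀ u ∈ Icc 0 s, HasDerivAt (fun u => logPartition ρ (θ₀ + ε * u) - c * u)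
        (deriv (logPartition ρ) (θ₀ + ε * u) * ε - c) u := by
      intro u hu
      have h1 : HasDerivAt (fun u : ℝ => θ₀ + ε * u) ε u := by
        simpa using ((hasDerivAt_id u).const_mul ε).const_add θ₀
      have h2 : HasDerivAt (fun u : ℝ => c * u) c u := by
        simpa using (hasDerivAt_id u).const_mul c
      exact ((hasDerivAt_logPartition hreg (hseg u hu)).comp u h1).sub h2
    have hle := (convex_Icc 0 s).image_sub_le_mul_sub_of_deriv_le (C := 0)
      (fun x hx => (hd x hx).continuousAt.continuousWithinAt)
      (fun x hx => (hd x (interior_subset hx)).differentiableAt.differentiableWithinAt)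
      (fun x hx => by
        rw [(hd x (interior_subset hx)).deriv]
        linarith [hc _ (hseg x (interior_subset hx))]) 0 ⟨le_rfl, hs⟩ s ⟨hs, le_rfl⟩ hs
    simp only [mul_zero, add_zero, sub_zero, zero_mul, tsub_le_iff_right, zero_add] at hle
    have hint : Integrable (fun x => Real.exp ((θ₀ + ε * s) * x - c * s)) ρ := by
      simp_rw [hexp]; exact Integrable.mul_const hmem _
    rw [← ofReal_integral_eq_lintegral_ofReal hint (ae_of_all _ fun x => (Real.exp_pos _).le)]
    refine ENNReal.ofReal_le_ofReal ?_
    simp_rw [hexp]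
    rw [integral_mul_const, ← Real.exp_log (integral_exp_pos hmem), ← Real.exp_add]
    refine Real.exp_le_exp.2 ?_
    have : Real.log (∫ x, Real.exp ((θ₀ + ε * s) * x) ∂ρ) = logPartition ρ (θ₀ + ε * s) := rfl
    linarith
  have hfatou : ∀ (u : ℕ → ℝ), (∀ n, ∫⁻ x, F (u n) x ∂ρ ≤ Z) →
      ∫⁻ x, liminf (fun n => F (u n) x) atTop ∂ρ ≤ Z := fun u hu =>
    (lintegral_liminf_le fun n => hF (u n)).trans
      (liminf_le_of_le (by isBoundedDefault) fun b hb => by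
        obtain ⟨n, hn⟩ := hb.exists
        exact hn.trans (hu n))
  -- The half-line of parameters cannot leave the natural parameter space: the admissible `s` form
  -- an open set by regularity and a closed one by Fatou's lemma.
  have hall : ∀ M : ℝ, 0 ≤ M → θ₀ + ε * M ∈ natParamSpace ρ := by
    intro M hM
    set S : Set ℝ := {s | θ₀ + ε * s ∈ natParamSpace ρ}
    have hSopen : IsOpen S := hreg.preimage (by fun_prop)
    have hclosed : IsClosed (S ∩ Icc 0 M) := by
      refine IsSeqClosed.isClosed fun u s hu hus => ?_
      have hs : s ∈ Icc 0 M := isClosed_Icc.mem_of_tendsto hus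
        (Eventually.of_forall fun n => (hu n).2)
      refine ⟨hmemF s ?_, hs⟩
      have := hfatou u fun n => hFmem _ (hu n).2.1 (hu n).1
      exact (lintegral_congr fun x =>
        (((hFc x).tendsto s).comp hus).liminf_eq).symm.trans_le this
    exact hclosed.Icc_subset_of_forall_mem_nhdsWithin (by simpa [S] using hθ₀)
      (fun x hx => mem_nhdsWithin_of_mem_nhds (hSopen.mem_nhds hx.1)) ⟨hM, le_rfl⟩
  have hfin := hfatou (fun n => (n : ℝ)) fun n => hFmem _ n.cast_nonneg (hall _ n.cast_nonneg)
  have hae := ae_lt_top' (Measurable.liminf fun n : ℕ => hF (n : ℝ)).aemeasurable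
    (hfin.trans_lt hZ.lt_top).ne
  refine measure_mono_null (fun x hx => ?_) (ae_iff.1 hae)
  have hx' : 0 < ε * x - c := sub_pos.2 hx
  have : Tendsto (fun n : ℕ => F (n : ℝ) x) atTop (𝓝 ∞) := by
    refine ENNReal.tendsto_ofReal_atTop.comp (Real.tendsto_exp_atTop.comp ?_)
    have h1 : ∀ n : ℕ, (θ₀ + ε * n) * x - c * n = θ₀ * x + (ε * x - c) * n := fun n => by ring
    simp_rw [h1]
    exact tendsto_atTop_add_const_left _ _
      (tendsto_natCast_atTop_atTop.const_mul_atTop hx')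
  simp [this.liminf_eq]

/-- The directional bound with `ε = 1` and `ε = -1` confines `ρ` between the infimum and the
supremum of the mean space, on each side where these are finite. -/
theorem ae_mem_closure_meanSpace [NeZero ρ] (hreg : IsOpen (natParamSpace ρ)) {θ : ℝ}
    (hθ : θ ∈ natParamSpace ρ) : ∀ᵐ x ∂ρ, x ∈ closure (meanSpace ρ) := by
  have hne : (meanSpace ρ).Nonempty := ⟨_, θ, hθ, rfl⟩
  have hoc := ordConnected_meanSpace hreg
  have hup : ∀ᵐ x ∂ρ, BddAbove (meanSpace ρ) → x ≤ sSup (meanSpace ρ) := by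
    by_cases hb : BddAbove (meanSpace ρ)
    · have := measure_direction_gt_eq_zero hreg (ε := 1) (c := sSup (meanSpace ρ)) hθ
        fun η hη => by rw [one_mul]; exact le_csSup hb ⟨η, hη, rfl⟩
      filter_upwards [measure_eq_zero_iff_ae_notMem.1 this] with x hx _
      simpa using hx
    · exact ae_of_all _ fun x h => absurd h hb
  have hlow : ∀ᵐ x ∂ρ, BddBelow (meanSpace ρ) → sInf (meanSpace ρ) ≤ x := by
    by_cases hb : BddBelow (meanSpace ρ)
    · have := measure_direction_gt_eq_zero hreg (ε := -1) (c := -sInf (meanSpace ρ)) hθ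
        fun η hη => by linarith [csInf_le hb (mem_image_of_mem (deriv (logPartition ρ)) hη)]
      filter_upwards [measure_eq_zero_iff_ae_notMem.1 this] with x hx _
      simpa using hx
    · exact ae_of_all _ fun x h => absurd h hb
  filter_upwards [hup, hlow] with x h1 h2
  by_contra hx
  have hxI : x ∉ meanSpace ρ := fun h => hx (subset_closure h)
  rcases em (∃ m ∈ meanSpace ρ, x < m) with ⟨m, hm, hxm⟩ | hno
  · have hlb : x ∈ lowerBounds (meanSpace ρ) := fun i hi => by
      by_contra hlt
      exact hxI (hoc.out hi hm ⟨(not_le.1 hlt).le, hxm.le⟩)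
    have : x = sInf (meanSpace ρ) := le_antisymm (le_csInf hne hlb) (h2 ⟨x, hlb⟩)
    exact hx (this ▸ csInf_mem_closure hne ⟨x, hlb⟩)
  · push Not at hno
    have : x = sSup (meanSpace ρ) := le_antisymm (h1 ⟨x, hno⟩) (csSup_le hne hno)
    exact hx (this ▸ csSup_mem_closure hne ⟨x, hno⟩)

end Support

/-! ### The extended divergence -/

section Extension

variable {ρ : Measure ℝ}

theorem approach_coe (x : ℝ) : approach ρ (x : EReal) = 𝓝[meanSpace ρ] x := by
  rw [approach, ← EReal.isEmbedding_coe.nhds_eq_comap]; rfl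

theorem approach_neBot {x : EReal} (hx : x ∈ meanClosure ρ) : (approach ρ x).NeBot := by
  rw [approach, inf_principal_neBot_iff]
  rintro U ⟨V, hV, hVU⟩
  obtain ⟨_, hyV, m, hm, rfl⟩ := mem_closure_iff_nhds.1 hx V hV
  exact ⟨m, hVU hyV, hm⟩

theorem eventually_mem_meanSpace (x : EReal) : ∀ᶠ m in approach ρ x, m ∈ meanSpace ρ :=
  mem_inf_of_right (mem_principal_self _)

theorem eventually_approach {x : EReal} {p : EReal → Prop} (h : ∀ᶠ y in 𝓝 x, p y) :
    ∀ᶠ m : ℝ in approach ρ x, p m :=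
  mem_inf_of_left (preimage_mem_comap h)

/-- Monotone convergence to the supremum. It certifies that the `limUnder` values in `klExt` are
genuine limits. -/
theorem exists_tendsto_of_eventually_le {F : Filter ℝ} {g : ℝ → ℝ≥0∞} {s : Set ℝ} (hs : s ∈ F)
    (h : ∀ m₀ ∈ s, ∀ᶠ m in F, g m₀ ≤ g m) : ∃ l, Tendsto g F (𝓝 l) := by
  refine ⟨sSup (g '' s), tendsto_order.2 ⟨fun c hc => ?_, fun c hc => ?_⟩⟩
  · obtain ⟨_, ⟨m₀, hm₀, rfl⟩, hlt⟩ := lt_sSup_iff.1 hc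
    exact (h m₀ hm₀).mono fun m hm => hlt.trans_le hm
  · filter_upwards [hs] with m hm
    exact (le_sSup (mem_image_of_mem g hm)).trans_lt hc

/-- With the parameter of `m₂` kept fixed, lowering the observation to `m₁` raises the likelihood
ratio; passing to the maximizing parameter of `m₁` raises it again. -/
theorem klMean_anti_left [NeZero ρ] (hreg : IsOpen (natParamSpace ρ))
    (hmono : StrictMonoOn (deriv (logPartition ρ)) (natParamSpace ρ)) {m₁ m₂ y : ℝ}
    (h₁ : m₁ ∈ meanSpace ρ) (h₂ : m₂ ∈ meanSpace ρ) (hy : y ∈ meanSpace ρ) (h₁₂ : m₁ ≤ m₂)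
    (h₂y : m₂ ≤ y) : klMean ρ m₂ y ≤ klMean ρ m₁ y := by
  rw [klMean_eq_logLik hreg h₁ hy, klMean_eq_logLik hreg h₂ hy]
  refine ENNReal.ofReal_le_ofReal ?_
  have h := logLik_le_logLik_mean hreg (natParam ρ y) (natParam_mem h₂) (natParam_mem h₁)
  rw [deriv_logPartition_natParam h₁] at h
  exact (logLik_anti (natParam_mono hmono h₂ hy h₂y) h₁₂).trans h

theorem klMean_mono_right [NeZero ρ] (hreg : IsOpen (natParamSpace ρ))
    (hmono : StrictMonoOn (deriv (logPartition ρ)) (natParamSpace ρ)) {x m₁ m₂ : ℝ}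
    (hx : x ∈ meanSpace ρ) (h₁ : m₁ ∈ meanSpace ρ) (h₂ : m₂ ∈ meanSpace ρ) (hx₁ : x ≤ m₁)
    (h₁₂ : m₁ ≤ m₂) : klMean ρ x m₁ ≤ klMean ρ x m₂ := by
  rw [klMean_eq_logLik hreg hx h₁, klMean_eq_logLik hreg hx h₂]
  refine ENNReal.ofReal_le_ofReal (logLik_mono_right hreg _ (natParam_mem h₁) (natParam_mem h₂)
    (natParam_mono hmono h₁ h₂ h₁₂) ?_)
  rwa [deriv_logPartition_natParam h₁]

/-- A point outside of the mean space and below one of its points is below all of them. -/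
theorem coe_lt_of_notMem (hreg : IsOpen (natParamSpace ρ)) {x : ℝ} (hx : x ∉ meanSpace ρ) {i : ℝ}
    (hi : i ∈ meanSpace ρ) (hxi : x < i) {m : ℝ} (hm : m ∈ meanSpace ρ) : x < m := by
  by_contra h
  exact hx ((ordConnected_meanSpace hreg).out hm hi ⟨not_lt.1 h, hxi.le⟩)

theorem lt_of_notMem_meanSpaceE (hreg : IsOpen (natParamSpace ρ)) {x : EReal}
    (hx : x ∉ meanSpaceE ρ) {i : ℝ} (hi : i ∈ meanSpace ρ) (hxi : (i : EReal) < x) {m : ℝ}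
    (hm : m ∈ meanSpace ρ) : (m : EReal) < x := by
  by_contra h
  have h := not_lt.1 h
  lift x to ℝ using ⟨(h.trans_lt (EReal.coe_lt_top m)).ne, ((EReal.bot_lt_coe i).trans hxi).ne'⟩
  exact hx ⟨x, (ordConnected_meanSpace hreg).out hi hm
    ⟨(EReal.coe_lt_coe_iff.1 hxi).le, EReal.coe_le_coe_iff.1 h⟩, rfl⟩

theorem tendsto_klMean_left [NeZero ρ] (hreg : IsOpen (natParamSpace ρ))
    (hmono : StrictMonoOn (deriv (logPartition ρ)) (natParamSpace ρ)) {x y : ℝ}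
    (hx : x ∉ meanSpace ρ) (hy : y ∈ meanSpace ρ) (hxy : x < y) :
    Tendsto (fun m => klMean ρ m y) (approach ρ (x : EReal))
      (𝓝 (limUnder (approach ρ (x : EReal)) fun m => klMean ρ m y)) := by
  refine tendsto_nhds_limUnder (exists_tendsto_of_eventually_le (s := meanSpace ρ ∩ Iio y)
    ?_ fun m₀ hm₀ => ?_)
  · rw [approach_coe]
    exact inter_mem self_mem_nhdsWithin (mem_nhdsWithin_of_mem_nhds (Iio_mem_nhds hxy))
  · have hlt := coe_lt_of_notMem hreg hx hy hxy hm₀.1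
    rw [approach_coe]
    filter_upwards [self_mem_nhdsWithin, mem_nhdsWithin_of_mem_nhds (Iio_mem_nhds hlt)]
      with m hm hmm
    exact klMean_anti_left hreg hmono hm hm₀.1 hy (le_of_lt hmm) hm₀.2.le

theorem tendsto_klMean_right [NeZero ρ] (hreg : IsOpen (natParamSpace ρ))
    (hmono : StrictMonoOn (deriv (logPartition ρ)) (natParamSpace ρ)) {x : ℝ} {y : EReal}
    (hx : x ∈ meanSpace ρ) (hy : y ∉ meanSpaceE ρ) (hxy : (x : EReal) < y) :
    Tendsto (fun m => klMean ρ x m) (approach ρ y)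
      (𝓝 (limUnder (approach ρ y) fun m => klMean ρ x m)) := by
  refine tendsto_nhds_limUnder (exists_tendsto_of_eventually_le (s := meanSpace ρ ∩ Ioi x)
    ?_ fun m₀ hm₀ => ?_)
  · filter_upwards [eventually_mem_meanSpace y, eventually_approach (lt_mem_nhds hxy)] with m h1 h2
    exact ⟨h1, EReal.coe_lt_coe_iff.1 h2⟩
  · have hlt := lt_of_notMem_meanSpaceE hreg hy hx hxy hm₀.1
    filter_upwards [eventually_mem_meanSpace y, eventually_approach (lt_mem_nhds hlt)] with m h1 h2
    exact klMean_mono_right hreg hmono hx hm₀.1 h1 hm₀.2.le (EReal.coe_lt_coe_iff.1 h2).le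

/-- Variational lower bound for the divergence inside of the mean space. -/
theorem logLik_le_klMean [NeZero ρ] (hreg : IsOpen (natParamSpace ρ))
    (hmono : StrictMonoOn (deriv (logPartition ρ)) (natParamSpace ρ)) {θ θ' x m : ℝ}
    (hθ : θ ∈ natParamSpace ρ) (hθ' : θ' ∈ natParamSpace ρ)
    (hx : x ∈ meanSpace ρ) (hm : m ∈ meanSpace ρ) (hxθ' : x ≤ deriv (logPartition ρ) θ')
    (hθ'm : deriv (logPartition ρ) θ' ≤ m) :
    ENNReal.ofReal (logLik ρ θ θ' x) ≤ klMean ρ x m := by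
  rw [klMean_eq_logLik hreg hx hm]
  refine ENNReal.ofReal_le_ofReal ?_
  have h1 := logLik_le_logLik_mean hreg (natParam ρ m) hθ (natParam_mem hx)
  rw [deriv_logPartition_natParam hx] at h1
  refine (logLik_mono_right hreg θ hθ' (natParam_mem hm) ?_ hxθ').trans h1
  rwa [← hmono.le_iff_le hθ' (natParam_mem hm), deriv_logPartition_natParam hm]

/-- Variational lower bound for the extended divergence. -/
theorem logLik_le_klExt [NeZero ρ] (hreg : IsOpen (natParamSpace ρ))
    (hmono : StrictMonoOn (deriv (logPartition ρ)) (natParamSpace ρ)) {θ θ' x : ℝ} {y : EReal}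
    (hθ : θ ∈ natParamSpace ρ) (hθ' : θ' ∈ natParamSpace ρ) (hle : θ ≤ θ')
    (hθ'y : ((deriv (logPartition ρ) θ' : ℝ) : EReal) ≤ y) :
    ENNReal.ofReal (logLik ρ θ θ' x) ≤ klExt ρ (x : EReal) y := by
  rcases le_or_gt (deriv (logPartition ρ) θ') x with hx | hx
  · rw [ENNReal.ofReal_of_nonpos (logLik_nonpos hreg hθ hθ' hle hx)]; exact bot_le
  have hI' : deriv (logPartition ρ) θ' ∈ meanSpace ρ := ⟨θ', hθ', rfl⟩
  have hxy : (x : EReal) < y := (EReal.coe_lt_coe_iff.2 hx).trans_le hθ'y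
  have hxE : ∀ {z : ℝ}, (z : EReal) ∈ meanSpaceE ρ → z ∈ meanSpace ρ := by
    rintro z ⟨w, hw, hwz⟩
    rwa [← EReal.coe_injective hwz]
  unfold klExt
  rw [if_neg hxy.ne]
  split_ifs with h1 h2 h3
  · obtain ⟨h1, m, hm, rfl⟩ := h1
    exact logLik_le_klMean hreg hmono hθ hθ' (hxE h1) hm hx.le (EReal.coe_le_coe_iff.1 hθ'y)
  · obtain ⟨hxc, m, hm, rfl⟩ := h2
    have hxI : x ∉ meanSpace ρ := fun h => h1 ⟨⟨x, h, rfl⟩, m, hm, rfl⟩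
    have := approach_neBot hxc
    refine le_of_tendsto_of_tendsto (f := fun z => ENNReal.ofReal (logLik ρ θ θ' z)) ?_
      (tendsto_klMean_left hreg hmono hxI hm (EReal.coe_lt_coe_iff.1 hxy)) ?_
    · rw [approach_coe]
      exact ((ENNReal.continuous_ofReal.comp (continuous_logLik θ θ')).tendsto x).mono_left
        nhdsWithin_le_nhds
    · rw [approach_coe]
      filter_upwards [self_mem_nhdsWithin, mem_nhdsWithin_of_mem_nhds (Iio_mem_nhds hx)]
        with z hz hzx
      exact logLik_le_klMean hreg hmono hθ hθ' hz hm (le_of_lt hzx)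
        (EReal.coe_le_coe_iff.1 hθ'y)
  · have hyI : y ∉ meanSpaceE ρ := fun h => h1 ⟨h3.1, h⟩
    have := approach_neBot h3.2
    refine ge_of_tendsto (tendsto_klMean_right hreg hmono (hxE h3.1) hyI hxy) ?_
    have hlt : ((deriv (logPartition ρ) θ' : ℝ) : EReal) < y :=
      hθ'y.lt_of_ne fun h => hyI (h ▸ ⟨_, hI', rfl⟩)
    filter_upwards [eventually_mem_meanSpace y, eventually_approach (lt_mem_nhds hlt)] with m hm hm'
    exact logLik_le_klMean hreg hmono hθ hθ' (hxE h3.1) hm hx.le (EReal.coe_lt_coe_iff.1 hm').le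
  · exact le_top

/-- A large extended divergence is witnessed by a likelihood ratio. -/
theorem exists_lt_logLik_of_lt_klExt [NeZero ρ] (hreg : IsOpen (natParamSpace ρ))
    (hmono : StrictMonoOn (deriv (logPartition ρ)) (natParamSpace ρ)) {θ' x c : ℝ}
    (hθ' : θ' ∈ natParamSpace ρ) (hx : x ∈ closure (meanSpace ρ))
    (hxθ' : x < deriv (logPartition ρ) θ') (hc : 0 ≤ c)
    (h : ENNReal.ofReal c < klExt ρ (x : EReal) (deriv (logPartition ρ) θ' : ℝ)) :
    ∃ θ ∈ natParamSpace ρ, θ < θ' ∧ c < logLik ρ θ θ' x := by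
  have hI' : deriv (logPartition ρ) θ' ∈ meanSpace ρ := ⟨θ', hθ', rfl⟩
  have hinner : ∀ z ∈ meanSpace ρ, z < deriv (logPartition ρ) θ' →
      ENNReal.ofReal c < klMean ρ z (deriv (logPartition ρ) θ') →
      ∃ θ ∈ natParamSpace ρ, θ < θ' ∧ c < logLik ρ θ θ' z := by
    intro z hz hzθ' hcz
    refine ⟨natParam ρ z, natParam_mem hz, ?_, ?_⟩
    · rwa [← hmono.lt_iff_lt (natParam_mem hz) hθ', deriv_logPartition_natParam hz]
    · rw [klMean_eq_logLik hreg hz hI', natParam_deriv_logPartition hmono hθ'] at hcz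
      exact (ENNReal.ofReal_lt_ofReal_iff_of_nonneg hc).1 hcz
  have hxy : (x : EReal) < (deriv (logPartition ρ) θ' : ℝ) := EReal.coe_lt_coe_iff.2 hxθ'
  have hxc : (x : EReal) ∈ meanClosure ρ :=
    image_closure_subset_closure_image continuous_coe_real_ereal ⟨x, hx, rfl⟩
  by_cases hxI : x ∈ meanSpace ρ
  · rw [klExt, if_neg hxy.ne, if_pos ⟨⟨x, hxI, rfl⟩, _, hI', rfl⟩, EReal.toReal_coe,
      EReal.toReal_coe] at h
    exact hinner x hxI hxθ' h
  · have hxE : (x : EReal) ∉ meanSpaceE ρ := by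
      rintro ⟨w, hw, hwx⟩
      exact hxI (EReal.coe_injective hwx ▸ hw)
    rw [klExt, if_neg hxy.ne, if_neg fun h => hxE h.1, if_pos ⟨hxc, _, hI', rfl⟩,
      EReal.toReal_coe] at h
    have := approach_neBot hxc
    have hev := (tendsto_klMean_left hreg hmono hxI hI' hxθ').eventually (lt_mem_nhds h)
    have hlt : ∀ᶠ z in approach ρ (x : EReal), z < deriv (logPartition ρ) θ' := by
      rw [approach_coe]
      exact mem_nhdsWithin_of_mem_nhds (Iio_mem_nhds hxθ')
    obtain ⟨z, ⟨hz1, hz2⟩, hz⟩ := ((hev.and hlt).and (eventually_mem_meanSpace _)).exists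
    obtain ⟨θ, hθ, hθθ', hcθ⟩ := hinner z hz hz2 hz1
    -- The witness was found at an interior point `z > x`; as `θ < θ'`, its likelihood ratio is only
    -- larger at `x`.
    exact ⟨θ, hθ, hθθ', hcθ.trans_le
      (logLik_anti hθθ'.le (coe_lt_of_notMem hreg hxI hI' hxθ' hz).le)⟩

end Extension

/-! ### Counting and averaging -/

section Counting

variable {Ω : Type*} {K : ℕ} {A : ℕ → Ω → Fin K} {Y : ℕ → Ω → ℝ} {ρ : Measure ℝ}

/-- The sum of the payoffs of arm `a` after round `t`. -/
noncomputable def paySum (A : ℕ → Ω → Fin K) (Y : ℕ → Ω → ℝ) (a : Fin K) (t : ℕ) (ω : Ω) : ℝ :=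
  ∑ s ∈ Finset.Icc 1 t, if A s ω = a then Y s ω else 0

theorem pulls_zero (a : Fin K) (ω : Ω) : pulls A a 0 ω = 0 := by simp [pulls]

theorem pulls_succ (a : Fin K) (t : ℕ) (ω : Ω) :
    pulls A a (t + 1) ω = pulls A a t ω + if A (t + 1) ω = a then 1 else 0 := by
  simp only [pulls, Finset.card_filter]
  exact Finset.sum_Icc_succ_top (by omega) _

theorem paySum_succ (a : Fin K) (t : ℕ) (ω : Ω) :
    paySum A Y a (t + 1) ω = paySum A Y a t ω + if A (t + 1) ω = a then Y (t + 1) ω else 0 :=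
  Finset.sum_Icc_succ_top (by omega) _

theorem pulls_mono (a : Fin K) (ω : Ω) : Monotone fun t => pulls A a t ω :=
  monotone_nat_of_le_succ fun t => by rw [pulls_succ]; omega

theorem pulls_le (a : Fin K) (t : ℕ) (ω : Ω) : pulls A a t ω ≤ t := by
  induction t with
  | zero => simp [pulls_zero]
  | succ t ih => rw [pulls_succ]; split_ifs <;> omega

theorem pulls_mul_empMean {a : Fin K} {t : ℕ} {ω : Ω} (h : 1 ≤ pulls A a t ω) :
    (pulls A a t ω : ℝ) * empMean A Y a t ω = paySum A Y a t ω := by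
  have : (pulls A a t ω : ℝ) ≠ 0 := by positivity
  exact mul_div_cancel₀ _ this

/-! ### Likelihood processes of the game -/

open Classical in
/-- The likelihood process which multiplies a factor `g (Y_{t+1})` at each time `t` for which
`G t` holds. -/
noncomputable def likelihood (G : ℕ → Set Ω) (g : ℝ → ℝ≥0∞) (Y : ℕ → Ω → ℝ) :
    ℕ → Ω → ℝ≥0∞
  | 0, _ => 1
  | t + 1, ω => likelihood G g Y t ω * if ω ∈ G t then g (Y (t + 1) ω) else 1

/-- The rounds before which arm `i` has been pulled less than `n` times, and at which it is
pulled. -/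
def pullBefore (A : ℕ → Ω → Fin K) (i : Fin K) (n : ℕ) (t : ℕ) : Set Ω :=
  {ω | A (t + 1) ω = i ∧ pulls A i t ω < n}

/-- As long as at most `n` pulls have occurred, no factor has been suppressed by the truncation. -/
theorem likelihood_eq_exp (i : Fin K) (η θ : ℝ) {n t : ℕ} {ω : Ω} (h : pulls A i t ω ≤ n) :
    likelihood (pullBefore A i n) (fun x => ENNReal.ofReal (Real.exp (logLik ρ η θ x))) Y t ω =
      ENNReal.ofReal (Real.exp ((η - θ) * paySum A Y i t ω +
        pulls A i t ω * (logPartition ρ θ - logPartition ρ η))) := by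
  induction t with
  | zero => simp [likelihood, pulls_zero, paySum]
  | succ t ih =>
    rw [pulls_succ] at h
    rw [likelihood, ih (by omega), pulls_succ, paySum_succ]
    by_cases hA : A (t + 1) ω = i
    · rw [if_pos hA] at h
      have hmem : ω ∈ pullBefore A i n t := ⟨hA, by omega⟩
      rw [if_pos hmem, if_pos hA, if_pos hA, ← ENNReal.ofReal_mul (Real.exp_pos _).le,
        ← Real.exp_add, logLik]
      push_cast
      ring_nf
    · have hmem : ω ∉ pullBefore A i n t := fun h => hA h.1
      simp [if_neg hmem, if_neg hA]

theorem likelihood_eq_of_le (i : Fin K) (g : ℝ → ℝ≥0∞) {n t T : ℕ} {ω : Ω}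
    (h : n ≤ pulls A i t ω) (htT : t ≤ T) :
    likelihood (pullBefore A i n) g Y T ω = likelihood (pullBefore A i n) g Y t ω := by
  induction T, htT using Nat.le_induction with
  | base => rfl
  | succ T htT ih =>
    have hmem : ω ∉ pullBefore A i n T := fun h' =>
      absurd (h.trans (pulls_mono i ω htT)) (not_le.2 h'.2)
    rw [likelihood, if_neg hmem, mul_one, ih]

theorem likelihood_eq_exp_logLik (i : Fin K) (η θ : ℝ) {n t : ℕ} {ω : Ω}
    (h1 : 1 ≤ pulls A i t ω) (h : pulls A i t ω ≤ n) :
    likelihood (pullBefore A i n) (fun x => ENNReal.ofReal (Real.exp (logLik ρ η θ x))) Y t ω =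
      ENNReal.ofReal (Real.exp (pulls A i t ω * logLik ρ η θ (empMean A Y i t ω))) := by
  rw [likelihood_eq_exp i η θ h, ← pulls_mul_empMean h1, logLik]
  ring_nf

end Counting

/-- The integrand is the density of `expFam ρ η` with respect to `expFam ρ θ`. -/
theorem lintegral_exp_logLik {ρ : Measure ℝ} [NeZero ρ] {θ η : ℝ}
    (hη : η ∈ natParamSpace ρ) :
    ∫⁻ x, ENNReal.ofReal (Real.exp (logLik ρ η θ x)) ∂(expFam ρ θ) = 1 := by
  have hc : Measurable fun x => ENNReal.ofReal (Real.exp (logLik ρ η θ x)) := by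
    unfold logLik; fun_prop
  rw [expFam, lintegral_withDensity_eq_lintegral_mul _ (by fun_prop) hc]
  have := (isProbabilityMeasure_expFam hη).measure_univ
  rw [expFam, withDensity_apply _ MeasurableSet.univ, setLIntegral_univ] at this
  rw [← this]
  refine lintegral_congr fun x => ?_
  rw [Pi.mul_apply, ← ENNReal.ofReal_mul (Real.exp_pos _).le, ← Real.exp_add, logLik]
  ring_nf

/-- The geometric grid of the peeling argument. -/
theorem exists_pow_le_le_pow_succ {r x : ℝ} {D : ℕ} (h1 : 1 ≤ x) (hx : x ≤ r ^ (D + 1)) :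
    ∃ k ∈ Finset.range (D + 1), r ^ k ≤ x ∧ x ≤ r ^ (k + 1) := by
  induction D with
  | zero => exact ⟨0, by simp, by simpa using h1, hx⟩
  | succ D ih =>
    rcases le_total x (r ^ (D + 1)) with h | h
    · obtain ⟨k, hk, hk'⟩ := ih h
      exact ⟨k, Finset.range_mono (Nat.le_succ _) hk, hk'⟩
    · exact ⟨D + 1, by simp, h, hx⟩

/-! ### Adaptedness of the pull counts and likelihood processes -/

section Measurability

variable {Ω : Type*} [mΩ : MeasurableSpace Ω] {P : Measure Ω} {ℱ : Filtration ℕ mΩ} {K : ℕ}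
  {A : ℕ → Ω → Fin K} {Y : ℕ → Ω → ℝ}

theorem IsBanditRun.measurable_likelihood {ν : Fin K → Measure ℝ}
    (hrun : IsBanditRun P ℱ ν A Y) {G : ℕ → Set Ω} (hG : ∀ t, MeasurableSet[ℱ t] (G t))
    {g : ℝ → ℝ≥0∞} (hg : Measurable g) (t : ℕ) : Measurable[ℱ t] (likelihood G g Y t) := by
  classical
  induction t with
  | zero => exact measurable_const
  | succ t ih =>
    have hle : ℱ t ≤ ℱ (t + 1) := ℱ.mono (Nat.le_succ t)
    exact (ih.mono hle le_rfl).mul (Measurable.ite (hle _ (hG t))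
      (hg.comp (hrun.measurable_payoff t)) measurable_const)

theorem IsBanditRun.measurable_pulls {ν : Fin K → Measure ℝ}
    (hrun : IsBanditRun P ℱ ν A Y) (a : Fin K) (t : ℕ) : Measurable[ℱ t] (pulls A a t) := by
  induction t with
  | zero =>
    have : pulls A a 0 = fun _ => 0 := funext fun ω => pulls_zero a ω
    rw [this]; exact measurable_const
  | succ t ih =>
    have hle : ℱ t ≤ ℱ (t + 1) := ℱ.mono (Nat.le_succ t)
    have : pulls A a (t + 1) = fun ω => pulls A a t ω + if A (t + 1) ω = a then 1 else 0 :=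
      funext fun ω => pulls_succ a t ω
    rw [this]
    exact (ih.mono hle le_rfl).add (Measurable.ite
      (hle _ (hrun.measurable_arm t (measurableSet_singleton a))) measurable_const
        measurable_const)

theorem IsBanditRun.measurableSet_pullBefore {ν : Fin K → Measure ℝ}
    (hrun : IsBanditRun P ℱ ν A Y) (i : Fin K) (n t : ℕ) :
    MeasurableSet[ℱ t] (pullBefore A i n t) :=
  (hrun.measurable_arm t (measurableSet_singleton i)).inter
    (hrun.measurable_pulls i t (measurableSet_Iio (a := n)))

end Measurability

/-! ### Likelihood martingales and Chernoff bounds -/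

section Martingale

variable {Ω : Type*} [mΩ : MeasurableSpace Ω] {P : Measure Ω} [IsProbabilityMeasure P]
  {ℱ : Filtration ℕ mΩ} {K : ℕ} {A : ℕ → Ω → Fin K} {Y : ℕ → Ω → ℝ}

theorem IsBanditRun.measure_inter {ν : Fin K → Measure ℝ} [∀ i, IsProbabilityMeasure (ν i)]
    (hrun : IsBanditRun P ℱ ν A Y) {t : ℕ} {i : Fin K} {G : Set Ω} (hG : MeasurableSet[ℱ t] G)
    (hGi : ∀ ω ∈ G, A (t + 1) ω = i) {B : Set ℝ} (hB : MeasurableSet B) :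
    P (Y (t + 1) ⁻¹' B ∩ G) = P G * ν i B := by
  have hG' := ℱ.le t _ hG
  have hYB : MeasurableSet (Y (t + 1) ⁻¹' B) :=
    ℱ.le (t + 1) _ (hrun.measurable_payoff t hB)
  have h1 := setIntegral_condExp (ℱ.le t)
    ((integrable_const (1 : ℝ)).indicator hYB : Integrable _ P) hG
  rw [setIntegral_congr_ae (g := fun _ => (ν i).real B) hG'
    ((hrun.payoff_law t B hB).mono fun ω hω hωG => by
      rw [hω]; simp only [hGi ω hωG]),
    setIntegral_const, integral_indicator_const _ hYB, smul_eq_mul, smul_eq_mul, mul_one,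
    measureReal_restrict_apply hYB] at h1
  rw [← ENNReal.toReal_eq_toReal_iff' (measure_ne_top _ _)
    (ENNReal.mul_ne_top (measure_ne_top _ _) (measure_ne_top _ _)), ENNReal.toReal_mul]
  exact h1.symm

theorem IsBanditRun.setLIntegral_payoff {ν : Fin K → Measure ℝ}
    [∀ i, IsProbabilityMeasure (ν i)] (hrun : IsBanditRun P ℱ ν A Y) {t : ℕ} {i : Fin K}
    {G : Set Ω} (hG : MeasurableSet[ℱ t] G) (hGi : ∀ ω ∈ G, A (t + 1) ω = i) {g : ℝ → ℝ≥0∞}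
    (hg : Measurable g) :
    ∫⁻ ω in G, g (Y (t + 1) ω) ∂P = P G * ∫⁻ x, g x ∂(ν i) := by
  have hY : Measurable (Y (t + 1)) := (hrun.measurable_payoff t).mono (ℱ.le _) le_rfl
  have hmap : (P.restrict G).map (Y (t + 1)) = P G • ν i := by
    ext B hB
    rw [Measure.map_apply hY hB, Measure.restrict_apply (hY hB), hrun.measure_inter hG hGi hB]
    simp
  rw [← lintegral_map hg hY, hmap, lintegral_smul_measure, smul_eq_mul]

/-- Applying the unweighted identity to `s ∩ G` for every past event `s` shows that two measures
agree on `ℱ t`; any past-measurable weight `W` can then be integrated against them. -/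
theorem IsBanditRun.setLIntegral_mul_payoff {ν : Fin K → Measure ℝ}
    [∀ i, IsProbabilityMeasure (ν i)] (hrun : IsBanditRun P ℱ ν A Y) {t : ℕ} {i : Fin K}
    {G : Set Ω} (hG : MeasurableSet[ℱ t] G) (hGi : ∀ ω ∈ G, A (t + 1) ω = i) {g : ℝ → ℝ≥0∞}
    (hg : Measurable g) {W : Ω → ℝ≥0∞} (hW : Measurable[ℱ t] W) :
    ∫⁻ ω in G, W ω * g (Y (t + 1) ω) ∂P = (∫⁻ ω in G, W ω ∂P) * ∫⁻ x, g x ∂(ν i) := by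
  have hY : Measurable (Y (t + 1)) := (hrun.measurable_payoff t).mono (ℱ.le _) le_rfl
  set c := ∫⁻ x, g x ∂(ν i)
  have htrim : ((P.restrict G).withDensity fun ω => g (Y (t + 1) ω)).trim (ℱ.le t) =
      (c • P.restrict G).trim (ℱ.le t) := by
    refine @Measure.ext _ (ℱ t) _ _ fun s hs => ?_
    rw [trim_measurableSet_eq _ hs, trim_measurableSet_eq _ hs,
      withDensity_apply _ (ℱ.le t _ hs), Measure.restrict_restrict (ℱ.le t _ hs),
      hrun.setLIntegral_payoff (hs.inter hG) (fun ω hω => hGi ω hω.2) hg, Measure.smul_apply,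
      Measure.restrict_apply (ℱ.le t _ hs), smul_eq_mul, mul_comm]
  have h1 := congrArg (fun Q => @lintegral _ (ℱ t) Q W) htrim
  simp only [lintegral_trim (ℱ.le t) hW] at h1
  rw [lintegral_withDensity_eq_lintegral_mul _ 
    (show Measurable fun ω => g (Y (t + 1) ω) from hg.comp hY) (hW.mono (ℱ.le t) le_rfl),
    lintegral_smul_measure, smul_eq_mul, mul_comm c] at h1
  rw [← h1]
  exact lintegral_congr fun ω => mul_comm _ _

theorem IsBanditRun.lintegral_likelihood {ν : Fin K → Measure ℝ}
    [∀ i, IsProbabilityMeasure (ν i)] (hrun : IsBanditRun P ℱ ν A Y) {i : Fin K}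
    {G : ℕ → Set Ω} (hG : ∀ t, MeasurableSet[ℱ t] (G t))
    (hGi : ∀ t, ∀ ω ∈ G t, A (t + 1) ω = i) {g : ℝ → ℝ≥0∞} (hg : Measurable g)
    (hg1 : ∫⁻ x, g x ∂(ν i) = 1) (t : ℕ) : ∫⁻ ω, likelihood G g Y t ω ∂P = 1 := by
  induction t with
  | zero => simp [likelihood]
  | succ t ih =>
    have hGt := ℱ.le t _ (hG t)
    rw [← ih, ← lintegral_add_compl _ hGt, ← lintegral_add_compl (likelihood G g Y t) hGt]
    congr 1
    · rw [setLIntegral_congr_fun (g := fun ω => likelihood G g Y t ω * g (Y (t + 1) ω)) hGt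
        fun ω hω => by simp only [likelihood, if_pos hω],
        hrun.setLIntegral_mul_payoff (hG t) (hGi t) hg (hrun.measurable_likelihood hG hg t), hg1,
        mul_one]
    · refine setLIntegral_congr_fun hGt.compl fun ω hω => ?_
      have hω' : ω ∉ G t := hω
      simp only [likelihood, if_neg hω', mul_one]

/-- Markov's inequality for a process of expectation 1. `E` need not be measurable. -/
theorem IsBanditRun.measure_le_of_le_likelihood {ν : Fin K → Measure ℝ}
    [∀ i, IsProbabilityMeasure (ν i)] (hrun : IsBanditRun P ℱ ν A Y) {i : Fin K}
    {G : ℕ → Set Ω} (hG : ∀ t, MeasurableSet[ℱ t] (G t))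
    (hGi : ∀ t, ∀ ω ∈ G t, A (t + 1) ω = i) {g : ℝ → ℝ≥0∞} (hg : Measurable g)
    (hg1 : ∫⁻ x, g x ∂(ν i) = 1) (t : ℕ) {E : Set Ω} {c : ℝ}
    (hE : ∀ ω ∈ E, ENNReal.ofReal (Real.exp c) ≤ likelihood G g Y t ω) :
    P E ≤ ENNReal.ofReal (Real.exp (-c)) := by
  have h := meas_ge_le_lintegral_div (μ := P)
    ((hrun.measurable_likelihood hG hg t).mono (ℱ.le t) le_rfl).aemeasurable
    (ENNReal.ofReal_pos.2 (Real.exp_pos c)).ne' ENNReal.ofReal_ne_top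
  rw [hrun.lintegral_likelihood hG hGi hg hg1, one_div,
    ← ENNReal.ofReal_inv_of_pos (Real.exp_pos c), ← Real.exp_neg] at h
  exact (measure_mono hE).trans h

variable {ρ : Measure ℝ} {θ : Fin K → ℝ}

/-- Chernoff bound for the empirical mean of the first `n` payoffs of an arm. -/
theorem IsBanditRun.measure_exists_pulls_eq_le [NeZero ρ] (hθ : ∀ i, θ i ∈ natParamSpace ρ)
    (hrun : IsBanditRun P ℱ (fun i => expFam ρ (θ i)) A Y) (i : Fin K) {η : ℝ}
    (hη : η ∈ natParamSpace ρ) {n : ℕ} (hn : 1 ≤ n) (T : ℕ) (c : ℝ) :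
    P {ω | ∃ t ≤ T, pulls A i t ω = n ∧ c ≤ n * logLik ρ η (θ i) (empMean A Y i t ω)} ≤
      ENNReal.ofReal (Real.exp (-c)) := by
  have : ∀ i, IsProbabilityMeasure (expFam ρ (θ i)) := fun i => isProbabilityMeasure_expFam (hθ i)
  refine hrun.measure_le_of_le_likelihood (hrun.measurableSet_pullBefore i n) (fun t ω h => h.1)
    (g := fun x => ENNReal.ofReal (Real.exp (logLik ρ η (θ i) x))) (by unfold logLik; fun_prop)
    (lintegral_exp_logLik hη) T ?_
  rintro ω ⟨t, htT, rfl, hc⟩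
  -- The process is frozen after the `n`-th pull, so its value at the fixed time `T` covers every
  -- `t` in the event and no union bound over `t` is needed.
  rw [likelihood_eq_of_le i _ le_rfl htT, likelihood_eq_exp_logLik i η (θ i) hn le_rfl]
  exact ENNReal.ofReal_le_ofReal (Real.exp_le_exp.2 hc)

theorem IsBanditRun.measure_le_pulls_mul_logLik [NeZero ρ] (hθ : ∀ i, θ i ∈ natParamSpace ρ)
    (hrun : IsBanditRun P ℱ (fun i => expFam ρ (θ i)) A Y) (i : Fin K) {η : ℝ}
    (hη : η ∈ natParamSpace ρ) (t : ℕ) (c : ℝ) :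
    P {ω | 1 ≤ pulls A i t ω ∧
        c ≤ pulls A i t ω * logLik ρ η (θ i) (empMean A Y i t ω)} ≤
      ENNReal.ofReal (Real.exp (-c)) := by
  have : ∀ i, IsProbabilityMeasure (expFam ρ (θ i)) := fun i => isProbabilityMeasure_expFam (hθ i)
  refine hrun.measure_le_of_le_likelihood (hrun.measurableSet_pullBefore i t) (fun t ω h => h.1)
    (g := fun x => ENNReal.ofReal (Real.exp (logLik ρ η (θ i) x))) (by unfold logLik; fun_prop)
    (lintegral_exp_logLik hη) t ?_
  rintro ω ⟨h1, hc⟩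
  rw [likelihood_eq_exp_logLik i η (θ i) h1 (pulls_le i t ω)]
  exact ENNReal.ofReal_le_ofReal (Real.exp_le_exp.2 hc)

/-! ### Peeling -/

/-- The witness `η` depends on the outcome, but since `η < θ i` the condition `δ / v ≤ logLik η` is
inherited by smaller empirical means. The event is thus covered by an increasing family of events
"empirical mean at most `q`", with `q` rational; each of them has a fixed witness, to which the
Chernoff bound applies. -/
theorem IsBanditRun.measure_slice_le [NeZero ρ] (hθ : ∀ i, θ i ∈ natParamSpace ρ)
    (hrun : IsBanditRun P ℱ (fun i => expFam ρ (θ i)) A Y) (i : Fin K) (t : ℕ) {δ u v : ℝ}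
    (hδ : 0 < δ) (hu : 0 < u) :
    P {ω | u ≤ pulls A i t ω ∧ pulls A i t ω ≤ v ∧ ∃ η ∈ natParamSpace ρ, η < θ i ∧
        δ < pulls A i t ω * logLik ρ η (θ i) (empMean A Y i t ω)} ≤
      ENNReal.ofReal (Real.exp (-(δ * (u / v)))) := by
  let Q : Set ℚ := {q | ∃ η ∈ natParamSpace ρ, η < θ i ∧ δ / v ≤ logLik ρ η (θ i) q}
  let S : Q → Set Ω := fun q => {ω | u ≤ pulls A i t ω ∧ pulls A i t ω ≤ v ∧
    empMean A Y i t ω ≤ (q : ℚ)}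
  have hsub : {ω | u ≤ pulls A i t ω ∧ pulls A i t ω ≤ v ∧ ∃ η ∈ natParamSpace ρ, η < θ i ∧
      δ < pulls A i t ω * logLik ρ η (θ i) (empMean A Y i t ω)} ⊆ ⋃ q, S q := by
    rintro ω ⟨h1, h2, η, hη, hηθ, h3⟩
    have hN : (0 : ℝ) < pulls A i t ω := hu.trans_le h1
    have hlt : δ / v < logLik ρ η (θ i) (empMean A Y i t ω) := by
      refine lt_of_le_of_lt ?_ ((div_lt_iff₀' hN).2 h3)
      gcongr
    obtain ⟨l, r, ⟨hl, hr⟩, hlr⟩ := mem_nhds_iff_exists_Ioo_subset.1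
      ((continuous_logLik η (θ i)).continuousAt.eventually (lt_mem_nhds hlt))
    obtain ⟨q, hq1, hq2⟩ := exists_rat_btwn hr
    have hq : δ / v < logLik ρ η (θ i) q := hlr ⟨hl.trans hq1, hq2⟩
    exact mem_iUnion.2 ⟨⟨q, η, hη, hηθ, hq.le⟩, h1, h2, hq1.le⟩
  have hmono : Monotone S := fun q q' hqq' ω hω =>
    ⟨hω.1, hω.2.1, hω.2.2.trans (by exact_mod_cast hqq')⟩
  refine (measure_mono hsub).trans ?_
  rw [hmono.directed_le.measure_iUnion]
  refine iSup_le fun q => ?_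
  obtain ⟨q, η, hη, hηθ, hq⟩ := q
  refine (measure_mono ?_).trans (hrun.measure_le_pulls_mul_logLik hθ i hη t (δ * (u / v)))
  rintro ω ⟨h1, h2, h3⟩
  have hN : (0 : ℝ) < pulls A i t ω := hu.trans_le h1
  have hv : 0 < v := hN.trans_le h2
  refine ⟨by exact_mod_cast hN, ?_⟩
  calc δ * (u / v) = u * (δ / v) := by ring
    _ ≤ pulls A i t ω * (δ / v) := by gcongr
    _ ≤ _ := by
      gcongr
      exact hq.trans (logLik_anti hηθ.le h3)

/-- Self-normalized deviation bound for the empirical mean of an arm. -/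
theorem IsBanditRun.measure_lt_pulls_mul_logLik [NeZero ρ] (hθ : ∀ i, θ i ∈ natParamSpace ρ)
    (hrun : IsBanditRun P ℱ (fun i => expFam ρ (θ i)) A Y) (i : Fin K) {t : ℕ} (ht : 2 ≤ t)
    {δ : ℝ} (hδ : 1 < δ) :
    P {ω | 1 ≤ pulls A i t ω ∧ ∃ η ∈ natParamSpace ρ, η < θ i ∧
        δ < pulls A i t ω * logLik ρ η (θ i) (empMean A Y i t ω)} ≤
      ENNReal.ofReal (⌈δ * Real.log t⌉₊ * Real.exp (1 - δ)) := by
  have hδ0 : 0 < δ := by linarith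
  have ht' : (2 : ℝ) ≤ t := by exact_mod_cast ht
  have hlog : 0 < Real.log t := Real.log_pos (by linarith)
  obtain ⟨D, hD⟩ : ∃ D, ⌈δ * Real.log t⌉₊ = D + 1 :=
    Nat.exists_eq_succ_of_ne_zero (Nat.ceil_pos.2 (mul_pos hδ0 hlog)).ne'
  -- With this ratio a slice has exponent `δ / r = δ - 1`, and `log r ≥ 1 - 1 / r = 1 / δ` lets `⌈δ
  -- log t⌉` slices cover `[1, t]`.
  set r : ℝ := δ / (δ - 1)
  have hδ1 : 0 < δ - 1 := by linarith
  have hr : 0 < r := div_pos hδ0 hδ1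
  have hlogr : δ⁻¹ ≤ Real.log r := by
    have h := Real.one_sub_inv_le_log_of_pos hr
    refine le_trans (le_of_eq ?_) h
    simp only [r]
    field_simp
    ring
  have htr : (t : ℝ) ≤ r ^ (D + 1) := by
    rw [← Real.log_le_log_iff (by linarith) (by positivity), Real.log_pow]
    have h1 : δ * Real.log t ≤ ((D + 1 : ℕ) : ℝ) := hD ▸ Nat.le_ceil _
    calc Real.log t = δ * Real.log t * δ⁻¹ := by field_simp
      _ ≤ ((D + 1 : ℕ) : ℝ) * Real.log r := by gcongr
  let S : ℕ → Set Ω := fun k => {ω | r ^ k ≤ pulls A i t ω ∧ pulls A i t ω ≤ r ^ (k + 1) ∧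
    ∃ η ∈ natParamSpace ρ, η < θ i ∧
      δ < pulls A i t ω * logLik ρ η (θ i) (empMean A Y i t ω)}
  have hS : ∀ k, P (S k) ≤ ENNReal.ofReal (Real.exp (1 - δ)) := fun k => by
    refine (hrun.measure_slice_le hθ i t hδ0 (pow_pos hr k)).trans (le_of_eq ?_)
    congr 2
    rw [pow_succ]
    simp only [r]
    field_simp
    ring
  have hsub : {ω | 1 ≤ pulls A i t ω ∧ ∃ η ∈ natParamSpace ρ, η < θ i ∧
      δ < pulls A i t ω * logLik ρ η (θ i) (empMean A Y i t ω)} ⊆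
      ⋃ k ∈ Finset.range (D + 1), S k := by
    rintro ω ⟨h1, h2⟩
    have hNt : (pulls A i t ω : ℝ) ≤ t := by exact_mod_cast pulls_le i t ω
    obtain ⟨k, hk, hk1, hk2⟩ := exists_pow_le_le_pow_succ
      (x := (pulls A i t ω : ℝ)) (by exact_mod_cast h1) (hNt.trans htr)
    exact mem_biUnion hk ⟨hk1, hk2, h2⟩
  calc _ ≤ P (⋃ k ∈ Finset.range (D + 1), S k) := measure_mono hsub
    _ ≤ ∑ k ∈ Finset.range (D + 1), P (S k) := measure_biUnion_finset_le _ _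
    _ ≤ ∑ k ∈ Finset.range (D + 1), ENNReal.ofReal (Real.exp (1 - δ)) :=
      Finset.sum_le_sum fun k _ => hS k
    _ = _ := by
      rw [hD, Finset.sum_const, Finset.card_range, nsmul_eq_mul,
        ENNReal.ofReal_mul (by positivity), ENNReal.ofReal_natCast]

end Martingale

/-! ### Numerical series -/

section Series

theorem one_lt_log_of_three_le {t : ℝ} (ht : 3 ≤ t) : 1 < Real.log t := by
  rw [Real.lt_log_iff_exp_lt (by linarith)]
  exact (Real.exp_one_lt_d9.trans (by norm_num)).trans_le ht

theorem explorationRate_of_three_le {t : ℕ} (ht : 3 ≤ t) :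
    explorationRate t = Real.log t + 3 * Real.log (Real.log t) := by
  rw [explorationRate, max_eq_left ht]

theorem explorationRate_mono : Monotone explorationRate := by
  intro s t hst
  have h3 : (3 : ℝ) ≤ (max s 3 : ℕ) := by exact_mod_cast le_max_right s 3
  have hle : ((max s 3 : ℕ) : ℝ) ≤ (max t 3 : ℕ) := by
    exact_mod_cast max_le_max_right 3 hst
  have h1 := one_lt_log_of_three_le h3
  have hlog : Real.log (max s 3 : ℕ) ≤ Real.log (max t 3 : ℕ) :=
    Real.log_le_log (by linarith) hle
  have hloglog := Real.log_le_log (by linarith) hlog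
  unfold explorationRate
  linarith

theorem one_lt_explorationRate (t : ℕ) : 1 < explorationRate t := by
  have h3 : (3 : ℝ) ≤ (max t 3 : ℕ) := by exact_mod_cast le_max_right t 3
  have h1 := one_lt_log_of_three_le h3
  have := Real.log_pos h1
  unfold explorationRate
  linarith

/-- With `u = log t`, the exponential is `e / (t u³)` and the ceiling is of order `u²`, so the
product is of order `1 / (t log t)`, which is comparable to the increment of `log log`. Starting at
6 gives `u ≥ 3 / 2`, which leaves room for the constant 4. -/
theorem ceil_mul_exp_explorationRate_le {t : ℕ} (ht : 6 ≤ t) :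
    ⌈explorationRate t * Real.log t⌉₊ * Real.exp (1 - explorationRate t) ≤
      4 * Real.exp 1 * (Real.log (Real.log ((t + 1 : ℕ) : ℝ)) - Real.log (Real.log t)) := by
  have ht6 : (6 : ℝ) ≤ t := by exact_mod_cast ht
  have ht0 : (0 : ℝ) < t := by linarith
  set u := Real.log t with hu
  have hu15 : 3 / 2 ≤ u := by
    rw [hu, Real.le_log_iff_exp_le ht0]
    refine le_trans ?_ ht6
    have h1 : Real.exp (3 / 2) ^ 2 = Real.exp 1 ^ 3 := by
      rw [← Real.exp_nat_mul, ← Real.exp_nat_mul]; norm_num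
    have h2 : Real.exp 1 ^ 3 ≤ 3 ^ 3 :=
      pow_le_pow_left₀ (Real.exp_pos _).le (Real.exp_one_lt_d9.le.trans (by norm_num)) 3
    nlinarith [Real.exp_pos (3 / 2)]
  have hu0 : 0 < u := by linarith
  have hf : explorationRate t = u + 3 * Real.log u := explorationRate_of_three_le (by omega)
  have hlogu0 : 0 < Real.log u := Real.log_pos (by linarith)
  have hlogu : Real.log u ≤ u * (37 / 100) := by
    have h1 := Real.log_le_sub_one_of_pos (div_pos hu0 (Real.exp_pos 1))
    rw [Real.log_div hu0.ne' (Real.exp_pos 1).ne', Real.log_exp] at h1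
    have h2 : u / Real.exp 1 ≤ u * (37 / 100) := by
      rw [div_le_iff₀ (Real.exp_pos 1)]
      nlinarith [Real.exp_one_gt_d9]
    linarith
  have hexp : Real.exp (1 - explorationRate t) = Real.exp 1 / (t * u ^ 3) := by
    have h3 : Real.exp (3 * Real.log u) = u ^ 3 := by
      rw [show (3 : ℝ) * Real.log u = (3 : ℕ) * Real.log u by norm_num, Real.exp_nat_mul,
        Real.exp_log hu0]
    rw [Real.exp_sub, hf, Real.exp_add, h3, hu, Real.exp_log ht0]
  -- From `log u ≤ 0.37 u`, which rounds up `1 / e`, one gets `f(t) u ≤ 2.11 u²`; the 1 lost in the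
  -- ceiling is at most `(4 / 9) u²`.
  have hceil : (⌈explorationRate t * u⌉₊ : ℝ) ≤ 2.56 * u ^ 2 := by
    have h1 := (Nat.ceil_lt_add_one (a := explorationRate t * u) (by rw [hf]; positivity)).le
    rw [hf] at h1 ⊢
    nlinarith [mul_le_mul_of_nonneg_right hlogu hu0.le]
  have hlt : Real.log ((t + 1 : ℕ) : ℝ) ≤ 10 / 9 * u ∧
      1 / ((t : ℝ) + 1) ≤ Real.log ((t + 1 : ℕ) : ℝ) - u := by
    push_cast
    constructor
    · have h1 := Real.log_le_sub_one_of_pos (div_pos (by linarith : (0 : ℝ) < t + 1) ht0)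
      rw [Real.log_div (by linarith) ht0.ne', add_div, div_self ht0.ne'] at h1
      have h2 : 1 / (t : ℝ) ≤ 1 / 6 := by gcongr
      linarith
    · have h1 := Real.one_sub_inv_le_log_of_pos (div_pos (by linarith : (0 : ℝ) < t + 1) ht0)
      rw [Real.log_div (by linarith) ht0.ne', inv_div] at h1
      refine le_trans (le_of_eq ?_) h1
      field_simp
      ring
  obtain ⟨hw1, hw2⟩ := hlt
  set w := Real.log ((t + 1 : ℕ) : ℝ)
  have hw0 : 0 < w := by
    have : 0 < 1 / ((t : ℝ) + 1) := by positivity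
    linarith
  -- Here `27 / 35 = (6 / 7) * (9 / 10)`, from `t + 1 ≤ (7 / 6) t` and `w ≤ (10 / 9) u`.
  have hdiff : 27 / 35 / (t * u) ≤ Real.log w - Real.log u := by
    have h1 := Real.one_sub_inv_le_log_of_pos (div_pos hw0 hu0)
    rw [Real.log_div hw0.ne' hu0.ne', inv_div] at h1
    refine le_trans ?_ h1
    have h2 : 1 - u / w = (w - u) / w := by field_simp
    rw [h2]
    calc 27 / 35 / (t * u) = (1 / (7 / 6 * t)) / (10 / 9 * u) := by field_simp; norm_num
      _ ≤ (1 / ((t : ℝ) + 1)) / w := by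
        gcongr
        linarith
      _ ≤ (w - u) / w := by gcongr
  rw [hexp]
  calc (⌈explorationRate t * u⌉₊ : ℝ) * (Real.exp 1 / (t * u ^ 3))
      ≤ 2.56 * u ^ 2 * (Real.exp 1 / (t * u ^ 3)) := by gcongr
    _ = 2.56 * Real.exp 1 / (t * u) := by field_simp
    _ ≤ 4 * Real.exp 1 * (27 / 35 / (t * u)) := by
      rw [← mul_div_assoc]
      exact div_le_div_of_nonneg_right (by nlinarith [Real.exp_pos 1]) (by positivity)
    _ ≤ _ := by gcongr

/-- The rounds 2 to 5 contribute at most 4 trivially; from 6 on the bound telescopes. -/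
theorem sum_Ico_explorationRate_le {p : ℕ → ℝ} (hp1 : ∀ t, p t ≤ 1)
    (hp : ∀ t, 2 ≤ t →
      p t ≤ ⌈explorationRate t * Real.log t⌉₊ * Real.exp (1 - explorationRate t))
    {T : ℕ} (hT : 3 ≤ T) :
    ∑ t ∈ Finset.Ico 2 T, p t ≤ 4 + 4 * Real.exp 1 * Real.log (Real.log T) := by
  have htriv : ∀ S, ∑ t ∈ Finset.Ico 2 S, p t ≤ ((S - 2 : ℕ) : ℝ) := fun S =>
    (Finset.sum_le_card_nsmul _ _ 1 fun t _ => hp1 t).trans (by simp)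
  have hLL : ∀ t : ℕ, 3 ≤ t → 0 < Real.log (Real.log t) := fun t ht =>
    Real.log_pos (one_lt_log_of_three_le (by exact_mod_cast ht))
  have he := Real.exp_pos 1
  rcases le_total T 6 with h | h
  · have h1 : ((T - 2 : ℕ) : ℝ) ≤ 4 := by exact_mod_cast (by omega : T - 2 ≤ 4)
    have := mul_pos he (hLL T hT)
    linarith [htriv T]
  · have hind : ∑ t ∈ Finset.Ico 2 T, p t ≤
        4 + 4 * Real.exp 1 * (Real.log (Real.log T) - Real.log (Real.log (6 : ℕ))) := by
      clear hT
      induction T, h using Nat.le_induction with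
      | base => simpa using htriv 6
      | succ T hT ih =>
        rw [Finset.sum_Ico_succ_top (by omega)]
        have h1 := (hp T (by omega)).trans (ceil_mul_exp_explorationRate_le hT)
        linarith
    have := mul_pos he (hLL 6 (by norm_num))
    linarith

theorem sum_range_le_integral_Ioi {f : ℝ → ℝ} (hf : AntitoneOn f (Ici 0))
    (hf0 : ∀ x, 0 ≤ f x) (hint : IntegrableOn f (Ioi 0)) (N : ℕ) :
    ∑ i ∈ Finset.range N, f ((i + 1 : ℕ) : ℝ) ≤ ∫ x in Ioi (0 : ℝ), f x := by
  have h := AntitoneOn.sum_le_integral (x₀ := 0) (a := N) (f := f)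
    (hf.mono Icc_subset_Ici_self)
  simp only [zero_add] at h
  rw [intervalIntegral.integral_of_le (by positivity)] at h
  exact h.trans (setIntegral_mono_set hint (ae_of_all _ hf0)
    (Ioc_subset_Ioi_self.eventuallyLE))

theorem sum_range_exp_neg_div_le {a : ℝ} (ha : 0 < a) (N : ℕ) :
    ∑ i ∈ Finset.range N, Real.exp (-a * ((i + 1 : ℕ) : ℝ)) ≤ 1 / a := by
  refine (sum_range_le_integral_Ioi (f := fun x => Real.exp (-a * x)) ?_
    (fun x => (Real.exp_pos _).le) (integrableOn_exp_mul_Ioi (by linarith) 0) N).trans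
    (le_of_eq ?_)
  · intro x _ y _ hxy
    exact Real.exp_le_exp.2 (by nlinarith)
  · rw [integral_exp_mul_Ioi (by linarith)]
    simp

theorem sum_range_exp_neg_mul_sq_le {b : ℝ} (hb : 0 < b) (N : ℕ) :
    ∑ i ∈ Finset.range N, Real.exp (-b * ((i + 1 : ℕ) : ℝ) ^ 2) ≤ √(Real.pi / b) / 2 := by
  rw [← integral_gaussian_Ioi]
  refine sum_range_le_integral_Ioi (f := fun x => Real.exp (-b * x ^ 2)) ?_
    (fun x => (Real.exp_pos _).le) (integrable_exp_neg_mul_sq hb).integrableOn N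
  intro x hx y _ hxy
  have hx : 0 ≤ x := hx
  have : x ^ 2 ≤ y ^ 2 := by gcongr
  exact Real.exp_le_exp.2 (by nlinarith)

/-- The first `⌊F⌋ + 1` terms are at most 1. Beyond them, either `n ≥ 2F`, so that `n ≤ 2(n - F)`
and the tail is exponential, or `n ≤ 2F` and the tail is Gaussian with variance of order `V F`. Each
term is bounded by the sum of both tails, and both series are compared with integrals. -/
theorem sum_range_le_of_chernoff {q : ℕ → ℝ} {F V : ℝ} (hF : 0 < F) (hV : 0 < V)
    (hq0 : ∀ n, 0 ≤ q n) (hq1 : ∀ n, q n ≤ 1)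
    (hq : ∀ n : ℕ, F < n → q n ≤ Real.exp (-((n - F) ^ 2 / (2 * V * n)))) (N : ℕ) :
    ∑ i ∈ Finset.range N, q (i + 1) ≤ F + 1 + 2 * √(2 * Real.pi * V * F) + 8 * V := by
  set M := ⌊F⌋₊
  have hterm : ∀ i : ℕ, q (M + 1 + i + 1) ≤ Real.exp (-(1 / (4 * V)) * ((i + 1 : ℕ) : ℝ)) +
      Real.exp (-(1 / (4 * V * F)) * ((i + 1 : ℕ) : ℝ) ^ 2) := by
    intro i
    set n := M + 1 + i + 1 with hn
    set j : ℝ := ((i + 1 : ℕ) : ℝ)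
    have hj : 0 ≤ j := by positivity
    have hjn : j ≤ n - F := by
      have h1 := (Nat.lt_floor_add_one F).le
      have h2 : (n : ℝ) = M + 1 + j := by simp only [hn, j]; push_cast; ring
      rw [h2]
      linarith
    have hFn : F < n := by
      have : 0 < j := by positivity
      linarith
    refine (hq n hFn).trans ?_
    rcases le_total F (n - F) with h | h
    · refine le_trans (Real.exp_le_exp.2 ?_) (le_add_of_nonneg_right (Real.exp_pos _).le)
      rw [neg_mul, neg_le_neg_iff, one_div_mul_eq_div, div_le_div_iff₀ (by positivity)
        (mul_pos (by positivity) (hF.trans hFn))]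
      have : j * n ≤ 2 * (n - F) ^ 2 := by nlinarith
      nlinarith
    · refine le_trans (Real.exp_le_exp.2 ?_) (le_add_of_nonneg_left (Real.exp_pos _).le)
      rw [neg_mul, neg_le_neg_iff, one_div_mul_eq_div, div_le_div_iff₀ (by positivity)
        (mul_pos (by positivity) (hF.trans hFn))]
      have h1 : j ^ 2 ≤ (n - F) ^ 2 := by gcongr
      have h2 : j ^ 2 * n ≤ (n - F) ^ 2 * (2 * F) := by
        gcongr
        linarith
      nlinarith
  calc ∑ i ∈ Finset.range N, q (i + 1)
      ≤ ∑ i ∈ Finset.range (M + 1 + N), q (i + 1) :=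
        Finset.sum_le_sum_of_subset_of_nonneg (Finset.range_mono (by omega)) fun i _ _ => hq0 _
    _ = ∑ i ∈ Finset.range (M + 1), q (i + 1) + ∑ i ∈ Finset.range N, q (M + 1 + i + 1) :=
        Finset.sum_range_add _ _ _
    _ ≤ (M + 1) + (4 * V + √(Real.pi * (4 * V * F)) / 2) := by
        gcongr
        · exact (Finset.sum_le_card_nsmul _ _ 1 fun i _ => hq1 _).trans (by simp)
        · refine (Finset.sum_le_sum fun i _ => hterm i).trans ?_
          rw [Finset.sum_add_distrib]
          have h1 := sum_range_exp_neg_div_le (a := 1 / (4 * V)) (by positivity) N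
          have h2 := sum_range_exp_neg_mul_sq_le (b := 1 / (4 * V * F)) (by positivity) N
          rw [one_div_one_div] at h1
          rw [div_div_eq_mul_div, div_one] at h2
          exact add_le_add h1 h2
    _ ≤ F + 1 + 2 * √(2 * Real.pi * V * F) + 8 * V := by
        have h1 := Nat.floor_le hF.le
        have h2 : √(Real.pi * (4 * V * F)) = √2 * √(2 * Real.pi * V * F) := by
          rw [← Real.sqrt_mul (by norm_num)]; ring_nf
        have h3 : √2 ≤ 2 := by rw [Real.sqrt_le_left (by norm_num)]; norm_num
        have h4 := Real.sqrt_nonneg (2 * Real.pi * V * F)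
        rw [h2]
        nlinarith

end Series

/-! ### The regret analysis -/

theorem measureReal_le_of_le_ofReal {Ω : Type*} [MeasurableSpace Ω] {P : Measure Ω} {s : Set Ω}
    {c : ℝ} (hc : 0 ≤ c)
    (h : P s ≤ ENNReal.ofReal c) : P.real s ≤ c :=
  (ENNReal.toReal_mono ENNReal.ofReal_ne_top h).trans_eq (ENNReal.toReal_ofReal hc)

/-! ### Consequences of low and high confidence bounds -/

section Index

variable {Ω : Type*} {K : ℕ} {A : ℕ → Ω → Fin K} {Y : ℕ → Ω → ℝ} {ρ : Measure ℝ}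

/-- Two tangent inequalities chained through the midpoint; strictness comes from the increase of the
slope in between. -/
theorem logLik_mean_pos [NeZero ρ] (hreg : IsOpen (natParamSpace ρ))
    (hmono : StrictMonoOn (deriv (logPartition ρ)) (natParamSpace ρ)) {θ θ' : ℝ}
    (hθ : θ ∈ natParamSpace ρ) (hθ' : θ' ∈ natParamSpace ρ) (hlt : θ < θ') :
    0 < logLik ρ θ θ' (deriv (logPartition ρ) θ) := by
  have hc : (θ + θ') / 2 ∈ natParamSpace ρ :=
    Icc_subset_natParamSpace hθ hθ' ⟨by linarith, by linarith⟩
  have h1 := logPartition_tangent_le hreg hθ hc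
  have h2 := logPartition_tangent_le hreg hc hθ'
  have h3 := hmono hθ hc (by linarith)
  have h4 := mul_lt_mul_of_pos_right h3 (by linarith : 0 < (θ' - θ) / 2)
  unfold logLik
  linarith

theorem empMean_mem_closure (hreg : IsOpen (natParamSpace ρ)) {ω : Ω}
    (hY : ∀ t, Y (t + 1) ω ∈ closure (meanSpace ρ)) {i : Fin K} {t : ℕ}
    (hN : 1 ≤ pulls A i t ω) : empMean A Y i t ω ∈ closure (meanSpace ρ) := by
  have hconv : Convex ℝ (closure (meanSpace ρ)) := (ordConnected_meanSpace hreg).convex.closure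
  have hN' : (pulls A i t ω : ℝ) ≠ 0 := by positivity
  have h := hconv.sum_mem (t := (Finset.Icc 1 t).filter fun s => A s ω = i)
    (w := fun _ => (pulls A i t ω : ℝ)⁻¹) (z := fun s => Y s ω) (fun _ _ => by positivity)
    (by rw [Finset.sum_const, nsmul_eq_mul]; exact mul_inv_cancel₀ hN') (fun s hs => by
      have h1 := (Finset.mem_Icc.1 (Finset.mem_filter.1 hs).1).1
      obtain ⟨s, rfl⟩ := Nat.exists_eq_succ_of_ne_zero (by omega : s ≠ 0)
      exact hY s)
  convert h using 1
  rw [empMean, ← Finset.sum_filter, ← Finset.smul_sum, smul_eq_mul, div_eq_inv_mul]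

/-- If the confidence bound of an arm is less than its expectation, the likelihood ratio of its
payoffs with respect to some smaller parameter is large. -/
theorem exists_logLik_of_ucbIndex_lt [NeZero ρ] (hreg : IsOpen (natParamSpace ρ))
    (hmono : StrictMonoOn (deriv (logPartition ρ)) (natParamSpace ρ)) {f : ℕ → ℝ} {t : ℕ}
    (hf : 0 ≤ f t) {ω : Ω} (hY : ∀ t, Y (t + 1) ω ∈ closure (meanSpace ρ)) {i : Fin K} {θ' : ℝ}
    (hθ' : θ' ∈ natParamSpace ρ) (hN : 1 ≤ pulls A i t ω)
    (hU : ucbIndex ρ f A Y i t ω < (deriv (logPartition ρ) θ' : ℝ)) :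
    ∃ η ∈ natParamSpace ρ, η < θ' ∧
      f t < pulls A i t ω * logLik ρ η θ' (empMean A Y i t ω) := by
  have hN' : (0 : ℝ) < pulls A i t ω := by exact_mod_cast hN
  have hx := empMean_mem_closure hreg hY hN
  set x := empMean A Y i t ω
  have hnot : ∀ m : EReal, ((deriv (logPartition ρ) θ' : ℝ) : EReal) ≤ m → m ∈ meanClosure ρ →
      ENNReal.ofReal (f t / pulls A i t ω) < klExt ρ (x : EReal) m := fun m hm hmc =>
    not_le.1 fun hle =>
      have hle_index : m ≤ ucbIndex ρ f A Y i t ω := le_sSup (And.intro hmc hle)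
      absurd (hm.trans hle_index) (not_le.2 hU)
  -- Otherwise `x` itself would be a candidate for the index, at divergence 0; this is where `x`
  -- must lie in the closure of the mean space.
  have hxlt : x < deriv (logPartition ρ) θ' := by
    by_contra hle
    have := hnot x (EReal.coe_le_coe_iff.2 (not_lt.1 hle))
      (image_closure_subset_closure_image continuous_coe_real_ereal (mem_image_of_mem _ hx))
    rw [klExt, if_pos rfl] at this
    exact absurd this not_lt_bot
  obtain ⟨η, hη, hηθ, hlt⟩ := exists_lt_logLik_of_lt_klExt hreg hmono hθ' hx hxlt
    (div_nonneg hf hN'.le) (hnot _ le_rfl (subset_closure (mem_image_of_mem _ (mem_image_of_mem _ hθ'))))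
  exact ⟨η, hη, hηθ, (div_lt_iff₀' hN').1 hlt⟩

/-- If the confidence bound of an arm is at least the expectation of parameter `θ'`, the likelihood
ratios of its payoffs with respect to `θ'` are small. -/
theorem logLik_le_of_le_ucbIndex [NeZero ρ] (hreg : IsOpen (natParamSpace ρ))
    (hmono : StrictMonoOn (deriv (logPartition ρ)) (natParamSpace ρ)) {f : ℕ → ℝ} {t : ℕ}
    (hf : 0 ≤ f t) {ω : Ω} {i : Fin K} {θ θ' : ℝ} (hθ : θ ∈ natParamSpace ρ)
    (hθ' : θ' ∈ natParamSpace ρ) (hlt : θ < θ')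
    (hU : ((deriv (logPartition ρ) θ' : ℝ) : EReal) ≤ ucbIndex ρ f A Y i t ω) :
    logLik ρ θ θ' (empMean A Y i t ω) ≤ f t / pulls A i t ω := by
  have hcont : ContinuousAt (fun η => logLik ρ θ η (empMean A Y i t ω)) θ' := by
    unfold logLik
    have := (hasDerivAt_logPartition hreg hθ').continuousAt
    fun_prop
  -- The supremum defining the index need not be attained, so the bound is proved for `η` slightly
  -- below `θ'` and passed to the limit.
  refine le_of_tendsto (hcont.tendsto.mono_left (nhdsWithin_le_nhds (s := Iio θ'))) ?_
  filter_upwards [self_mem_nhdsWithin, mem_nhdsWithin_of_mem_nhds (Ioi_mem_nhds hlt)]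
    with η hη hη'
  have hηΘ : η ∈ natParamSpace ρ :=
    Icc_subset_natParamSpace hθ hθ' ⟨le_of_lt hη', le_of_lt hη⟩
  obtain ⟨m, ⟨-, hm⟩, hlt⟩ := lt_sSup_iff.1
    ((EReal.coe_lt_coe_iff.2 (hmono hηΘ hθ' hη)).trans_le hU)
  exact (ENNReal.ofReal_le_ofReal_iff (by positivity)).1
    ((logLik_le_klExt hreg hmono hθ hηΘ (le_of_lt hη') hlt.le).trans hm)

/-- Deterministic bound on the number of pulls of an arm: each pull after the initialization
either falls in a round of `E`, or is the `n`-th pull for some `n` in `D`. -/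
theorem pulls_le_sum_indicator {a : Fin K} {ω : Ω} {S T : ℕ} (E : ℕ → Set Ω) (D : ℕ → Set Ω)
    (hS : pulls A a S ω = 1) (hST : S ≤ T)
    (h : ∀ t, S ≤ t → t < T → A (t + 1) ω = a → ω ∈ E t ∨ ω ∈ D (pulls A a t ω)) :
    (pulls A a T ω : ℝ) ≤ 1 + ∑ t ∈ Finset.Ico S T, (E t).indicator 1 ω +
      ∑ n ∈ Finset.Ico 1 (pulls A a T ω), (D n).indicator 1 ω := by
  induction T, hST using Nat.le_induction with
  | base => simp [hS]
  | succ T hST ih =>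
    have ih := ih fun t h1 h2 => h t h1 (h2.trans (Nat.lt_succ_self T))
    have h1 : 1 ≤ pulls A a T ω := hS ▸ pulls_mono a ω hST
    have hE : (0 : ℝ) ≤ (E T).indicator 1 ω := indicator_nonneg (fun _ _ => zero_le_one) ω
    rw [Finset.sum_Ico_succ_top hST, pulls_succ]
    by_cases hA : A (T + 1) ω = a
    · have hD : (0 : ℝ) ≤ (D (pulls A a T ω)).indicator 1 ω :=
        indicator_nonneg (fun _ _ => zero_le_one) ω
      rw [if_pos hA, Finset.sum_Ico_succ_top h1]
      push_cast
      rcases h T hST (Nat.lt_succ_self T) hA with h2 | h2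
      · have h3 : (E T).indicator (1 : Ω → ℝ) ω = 1 := by simp [h2]
        linarith
      · have h3 : (D (pulls A a T ω)).indicator (1 : Ω → ℝ) ω = 1 := by simp [h2]
        linarith
    · rw [if_neg hA, add_zero]
      linarith

end Index

/-! ### Deviations of the suboptimal arm and assembly of the bound -/

section Regret

variable {Ω : Type*} [mΩ : MeasurableSpace Ω] {P : Measure Ω} [IsProbabilityMeasure P]
  {ℱ : Filtration ℕ mΩ} {K : ℕ} {A : ℕ → Ω → Fin K} {Y : ℕ → Ω → ℝ} {ρ : Measure ℝ}
  {θ : Fin K → ℝ}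

theorem IsBanditRun.ae_payoff_mem_closure [NeZero ρ] (hreg : IsOpen (natParamSpace ρ))
    (hθ : ∀ i, θ i ∈ natParamSpace ρ) (hrun : IsBanditRun P ℱ (fun i => expFam ρ (θ i)) A Y) :
    ∀ᵐ ω ∂P, ∀ t, Y (t + 1) ω ∈ closure (meanSpace ρ) := by
  have : ∀ i, IsProbabilityMeasure (expFam ρ (θ i)) := fun i => isProbabilityMeasure_expFam (hθ i)
  rw [ae_all_iff]
  intro t
  have h : ∀ i, P (Y (t + 1) ⁻¹' (closure (meanSpace ρ))ᶜ ∩ {ω | A (t + 1) ω = i}) = 0 := by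
    intro i
    have hG : MeasurableSet[ℱ t] {ω | A (t + 1) ω = i} :=
      hrun.measurable_arm t (measurableSet_singleton i)
    rw [hrun.measure_inter hG (fun ω hω => hω) isClosed_closure.measurableSet.compl]
    have h0 : expFam ρ (θ i) (closure (meanSpace ρ))ᶜ = 0 :=
      expFam_absolutelyContinuous (θ i) (ae_iff.1 (ae_mem_closure_meanSpace hreg (hθ i)))
    rw [h0, mul_zero]
  refine measure_mono_null (fun ω hω => ?_) (measure_iUnion_null h)
  exact mem_iUnion.2 ⟨A (t + 1) ω, hω, rfl⟩

/-- Sub-Gaussian deviation bound for the arm of parameter `θ i`, in terms of the likelihood ratio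
with respect to a larger parameter `θ'`. -/
theorem IsBanditRun.measure_logLik_le_le [NeZero ρ] (hreg : IsOpen (natParamSpace ρ))
    (hθ : ∀ i, θ i ∈ natParamSpace ρ) (hrun : IsBanditRun P ℱ (fun i => expFam ρ (θ i)) A Y)
    (i : Fin K) {θ' v d F : ℝ} (hθ' : θ' ∈ natParamSpace ρ) (hlt : θ i < θ') (hv : 0 < v)
    (hbound : ∀ η ∈ Icc (θ i) θ', deriv (deriv (logPartition ρ)) η ≤ v)
    (hd : d = logLik ρ (θ i) θ' (deriv (logPartition ρ) (θ i))) (hd0 : 0 < d) (hF : 0 < F)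
    {n : ℕ} (hn : F < n) (T : ℕ) :
    P {ω | ∃ t ≤ T, pulls A i t ω = n ∧
        logLik ρ (θ i) θ' (empMean A Y i t ω) ≤ d * F / n} ≤
      ENNReal.ofReal (Real.exp (-((n - F) ^ 2 / (2 * (v * (θ i - θ') ^ 2 / d ^ 2) * n)))) := by
  set β := deriv (logPartition ρ) (θ i) with hβ
  set Δ := θ' - θ i with hΔ
  have hΔ0 : 0 < Δ := sub_pos.2 hlt
  have hn0 : (0 : ℝ) < n := hF.trans hn
  have hdv : d ≤ v * Δ ^ 2 / 2 := by
    have := logPartition_le_quadratic hreg (hθ i) hθ' hlt.le hbound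
    rw [hd, logLik]
    linarith
  -- At the true mean the likelihood ratio equals `d`, and its slope in the observation is `-Δ`; the
  -- event therefore forces a deviation of at least `e / Δ`.
  set e := d - d * F / n with he
  have he0 : 0 < e := by
    have : d * F / n < d := by rw [div_lt_iff₀ hn0]; gcongr
    linarith
  have hed : e ≤ d := by
    have : 0 ≤ d * F / n := by positivity
    linarith
  -- The maximizer of `r * (e / Δ) - v * r ^ 2 / 2`. The inequality `d ≤ v Δ² / 2` keeps `θ i + r`
  -- in the interval where `v` bounds the variance.
  set r := e / (Δ * v) with hr
  have hr0 : 0 < r := by positivity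
  have hrΔ : r ≤ Δ := by
    rw [hr, div_le_iff₀ (by positivity)]
    nlinarith [mul_pos hv (pow_pos hΔ0 2)]
  have hη : θ i + r ∈ natParamSpace ρ :=
    Icc_subset_natParamSpace (hθ i) hθ' ⟨by linarith, by linarith⟩
  have hquad := logPartition_le_quadratic hreg (hθ i) hη (by linarith)
    fun η hη => hbound η ⟨hη.1, hη.2.trans (by linarith)⟩
  rw [add_sub_cancel_left, ← hβ] at hquad
  refine (measure_mono ?_).trans (hrun.measure_exists_pulls_eq_le hθ i hη
    (by exact_mod_cast hn0) T _)
  rintro ω ⟨t, htT, hN, hle⟩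
  refine ⟨t, htT, hN, ?_⟩
  set x := empMean A Y i t ω
  have hdev : e ≤ Δ * (x - β) := by
    have h1 : logLik ρ (θ i) θ' x = d - Δ * (x - β) := by
      rw [hd, logLik, logLik]; ring
    linarith
  have hr2 : r * (x - β) ≥ e ^ 2 / (Δ ^ 2 * v) := by
    have : e / Δ ≤ x - β := by rwa [div_le_iff₀' hΔ0]
    calc e ^ 2 / (Δ ^ 2 * v) = r * (e / Δ) := by rw [hr]; field_simp
      _ ≤ r * (x - β) := by gcongr
  have hr3 : v * r ^ 2 / 2 = e ^ 2 / (Δ ^ 2 * v) / 2 := by rw [hr]; field_simp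
  have hL : e ^ 2 / (Δ ^ 2 * v) / 2 ≤ logLik ρ (θ i + r) (θ i) x := by
    rw [logLik]
    linarith
  calc (n - F) ^ 2 / (2 * (v * (θ i - θ') ^ 2 / d ^ 2) * n)
      = n * (e ^ 2 / (Δ ^ 2 * v) / 2) := by
        rw [he, show θ i - θ' = -Δ by rw [hΔ]; ring]
        field_simp
    _ ≤ _ := by gcongr

/-- `E t` and `D n` are not known to be measurable, so the pathwise bound is integrated over their
measurable hulls, which have the same measure. -/
theorem integral_pulls_le_sum {a : Fin K} {S T : ℕ} (E : ℕ → Set Ω) (D : ℕ → Set Ω)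
    (hS : ∀ᵐ ω ∂P, pulls A a S ω = 1) (hST : S ≤ T)
    (h : ∀ᵐ ω ∂P, ∀ t, S ≤ t → t < T → A (t + 1) ω = a → ω ∈ E t ∨ ω ∈ D (pulls A a t ω)) :
    ∫ ω, (pulls A a T ω : ℝ) ∂P ≤ 1 + ∑ t ∈ Finset.Ico S T, P.real (E t) +
      ∑ i ∈ Finset.range T, P.real (D (i + 1)) := by
  have hm : ∀ B : Set Ω, MeasurableSet (toMeasurable P B) := measurableSet_toMeasurable P
  have hi : ∀ B : Set Ω, Integrable ((toMeasurable P B).indicator (1 : Ω → ℝ)) P := fun B =>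
    (integrable_const (1 : ℝ)).indicator (hm B)
  have hv : ∀ B : Set Ω, ∫ ω, (toMeasurable P B).indicator (1 : Ω → ℝ) ω ∂P = P.real B :=
    fun B => by rw [integral_indicator_one (hm B), measureReal_def, measure_toMeasurable]; rfl
  have hi1 : Integrable (fun ω => ∑ t ∈ Finset.Ico S T,
      (toMeasurable P (E t)).indicator (1 : Ω → ℝ) ω) P :=
    integrable_finsetSum _ fun t _ => hi (E t)
  have hi2 : Integrable (fun ω => ∑ i ∈ Finset.range T,
      (toMeasurable P (D (i + 1))).indicator (1 : Ω → ℝ) ω) P :=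
    integrable_finsetSum _ fun i _ => hi (D (i + 1))
  have hi0 : Integrable (fun ω => 1 + ∑ t ∈ Finset.Ico S T,
      (toMeasurable P (E t)).indicator (1 : Ω → ℝ) ω) P := (integrable_const _).add hi1
  refine (integral_mono_of_nonneg (ae_of_all _ fun ω => Nat.cast_nonneg _) (hi0.add hi2)
    ?_).trans (le_of_eq ?_)
  · filter_upwards [hS, h] with ω hSω hω
    refine (pulls_le_sum_indicator (fun t => toMeasurable P (E t)) (fun n => toMeasurable P (D n))
      hSω hST fun t h1 h2 h3 => ?_).trans ?_
    · exact (hω t h1 h2 h3).imp (fun h => subset_toMeasurable _ _ h)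
        fun h => subset_toMeasurable _ _ h
    · refine add_le_add_right ?_ _
      beta_reduce
      rw [Finset.range_eq_Ico, Finset.sum_Ico_add' (fun n =>
        (toMeasurable P (D n)).indicator (1 : Ω → ℝ) ω) 0 T 1]
      refine Finset.sum_le_sum_of_subset_of_nonneg
        (Finset.Ico_subset_Ico (by omega) ((pulls_le a T ω).trans (by omega)))
        fun n _ _ => indicator_nonneg (fun _ _ => zero_le_one) ω
  · simp only [Pi.add_apply]
    rw [integral_add hi0 hi2, integral_add (integrable_const _) hi1,
      integral_finsetSum _ fun t _ => hi (E t), integral_finsetSum _ fun i _ => hi (D (i + 1))]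
    simp [hv]

theorem IsKlUCB.integral_pulls_le [NeZero ρ] (hreg : IsOpen (natParamSpace ρ))
    (hmono : StrictMonoOn (deriv (logPartition ρ)) (natParamSpace ρ))
    (hθ : ∀ i, θ i ∈ natParamSpace ρ) (hrun : IsBanditRun P ℱ (fun i => expFam ρ (θ i)) A Y)
    (halg : IsKlUCB P ρ explorationRate A Y) {a star : Fin K} (hlt : θ a < θ star) {v d : ℝ}
    (hv : 0 < v) (hbound : ∀ η ∈ Icc (θ a) (θ star), deriv (deriv (logPartition ρ)) η ≤ v)
    (hd : d = logLik ρ (θ a) (θ star) (deriv (logPartition ρ) (θ a))) (hd0 : 0 < d)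
    {T : ℕ} (hT : 3 ≤ T) :
    ∫ ω, (pulls A a T ω : ℝ) ∂P ≤ explorationRate T / d +
      2 * √(2 * Real.pi * (v * (θ a - θ star) ^ 2 / d ^ 2) * (explorationRate T / d)) +
      4 * Real.exp 1 * Real.log (Real.log T) + 8 * (v * (θ a - θ star) ^ 2 / d ^ 2) + 6 := by
  set V := v * (θ a - θ star) ^ 2 / d ^ 2 with hV
  set F := explorationRate T / d with hF
  have hfT : 0 < explorationRate T := zero_lt_one.trans (one_lt_explorationRate T)
  have hF0 : 0 < F := div_pos hfT hd0
  have hV0 : 0 < V := by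
    have : θ a - θ star ≠ 0 := (sub_neg.2 hlt).ne
    positivity
  have hK : 2 ≤ K := by
    have h1 := a.isLt
    have h2 := star.isLt
    have h3 : (a : ℕ) ≠ star := fun h => hlt.ne (by rw [Fin.ext h])
    omega
  have hLL : 0 < Real.log (Real.log T) :=
    Real.log_pos (one_lt_log_of_three_le (by exact_mod_cast hT))
  have he := mul_pos (Real.exp_pos 1) hLL
  -- A horizon inside the initialization allows at most one pull.
  rcases le_total T K with hTK | hKT
  · have h1 : ∫ ω, (pulls A a T ω : ℝ) ∂P ≤ ∫ _, (1 : ℝ) ∂P := by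
      refine integral_mono_of_nonneg (ae_of_all _ fun ω => Nat.cast_nonneg _)
        (integrable_const _) ?_
      filter_upwards [halg.init] with ω hω
      exact_mod_cast (pulls_mono a ω hTK).trans (hω a).le
    have h2 := Real.sqrt_nonneg (2 * Real.pi * V * F)
    simp only [integral_const, probReal_univ, smul_eq_mul, mul_one] at h1
    linarith
  let E : ℕ → Set Ω := fun t => {ω | 1 ≤ pulls A star t ω ∧ ∃ η ∈ natParamSpace ρ, η < θ star ∧
    explorationRate t < pulls A star t ω * logLik ρ η (θ star) (empMean A Y star t ω)}
  let D : ℕ → Set Ω := fun n => {ω | ∃ t ≤ T, pulls A a t ω = n ∧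
    logLik ρ (θ a) (θ star) (empMean A Y a t ω) ≤ d * F / n}
  have hcount := integral_pulls_le_sum (P := P) (A := A) (a := a) E D
    (halg.init.mono fun ω hω => hω a) hKT (by
      filter_upwards [halg.init, halg.argmax, hrun.ae_payoff_mem_closure hreg hθ]
        with ω hinit hmax hY t hKt htT hA
      have hf0 : 0 ≤ explorationRate t := zero_le_one.trans (one_lt_explorationRate t).le
      have hN : ∀ i, 1 ≤ pulls A i t ω := fun i => (hinit i).symm.le.trans (pulls_mono i ω hKt)
      by_cases hU : ucbIndex ρ explorationRate A Y star t ω <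
          (deriv (logPartition ρ) (θ star) : ℝ)
      · exact Or.inl ⟨hN star, exists_logLik_of_ucbIndex_lt hreg hmono hf0 hY (hθ star)
          (hN star) hU⟩
      · refine Or.inr ⟨t, htT.le, rfl, ?_⟩
        have hUa := (not_lt.1 hU).trans (hmax t hKt star)
        rw [hA] at hUa
        refine (logLik_le_of_le_ucbIndex hreg hmono hf0 (hθ a) (hθ star) hlt hUa).trans ?_
        have hdF : d * F = explorationRate T := by rw [hF]; field_simp
        rw [hdF]
        exact div_le_div_of_nonneg_right (explorationRate_mono htT.le) (by positivity))
  have hE : ∑ t ∈ Finset.Ico K T, P.real (E t) ≤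
      4 + 4 * Real.exp 1 * Real.log (Real.log T) := by
    refine (Finset.sum_le_sum_of_subset_of_nonneg (Finset.Ico_subset_Ico_left hK)
      fun _ _ _ => measureReal_nonneg).trans
      (sum_Ico_explorationRate_le (fun t => measureReal_le_one) (fun t ht => ?_) hT)
    exact measureReal_le_of_le_ofReal (by positivity)
      (hrun.measure_lt_pulls_mul_logLik hθ star ht (one_lt_explorationRate t))
  have hD := sum_range_le_of_chernoff (q := fun n => P.real (D n)) hF0 hV0
    (fun n => measureReal_nonneg) (fun n => measureReal_le_one) (fun n hn =>
      measureReal_le_of_le_ofReal (Real.exp_pos _).le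
        (hrun.measure_logLik_le_le hreg hθ a (hθ star) hlt hv hbound hd hd0 hF0 hn T)) T
  -- The constant 6 collects the initialization pull, the 4 from the small rounds and the 1 from
  -- rounding `F`.
  linarith

end Regret

end KLUCB

theorem theorem1 {Ω : Type*} [mΩ : MeasurableSpace Ω] (P : Measure Ω) [IsProbabilityMeasure P]
    (ℱ : Filtration ℕ mΩ) {K : ℕ}
    (ρ : Measure ℝ) (hreg : IsOpen (KLUCB.natParamSpace ρ))
    (θ : Fin K → ℝ) (hθ : ∀ i, θ i ∈ KLUCB.natParamSpace ρ)
    (A : ℕ → Ω → Fin K) (Y : ℕ → Ω → ℝ)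
    (hrun : KLUCB.IsBanditRun P ℱ (fun i => KLUCB.expFam ρ (θ i)) A Y)
    (halg : KLUCB.IsKlUCB P ρ KLUCB.explorationRate A Y)
    (μ : Fin K → ℝ) (hμ : ∀ i, μ i = KLUCB.mean (KLUCB.expFam ρ (θ i)))
    (a star : Fin K) (hstar : ∀ i, μ i ≤ μ star) (ha : μ a < μ star)
    (d : ℝ) (hd : d = (KLUCB.klMean ρ (μ a) (μ star)).toReal) :
    ∃ d' σ2 : ℝ,
      HasDerivAt (fun m => (KLUCB.klMean ρ m (μ star)).toReal) d' (μ a) ∧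
      IsGreatest {v : ℝ | ∃ η ∈ KLUCB.natParamSpace ρ,
        μ a ≤ KLUCB.mean (KLUCB.expFam ρ η) ∧ KLUCB.mean (KLUCB.expFam ρ η) ≤ μ star ∧
        v = variance id (KLUCB.expFam ρ η)} σ2 ∧
      ∀ T : ℕ, 3 ≤ T →
        ∫ ω, (KLUCB.pulls A a T ω : ℝ) ∂P ≤
          Real.log T / d
          + 2 * Real.sqrt (2 * Real.pi * σ2 * d' ^ 2 / d ^ 3)
              * Real.sqrt (Real.log T + 3 * Real.log (Real.log T))
          + (4 * Real.exp 1 + 3 / d) * Real.log (Real.log T)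
          + 8 * σ2 * (d' / d) ^ 2 + 6 := by
  open KLUCB in
  -- For `ρ = 0` every mean would be 0, so no arm would be suboptimal.
  have hρ : NeZero ρ := ⟨by
    rintro rfl
    simp [hμ, mean, expFam] at ha⟩
  have hμ' : ∀ i, μ i = deriv (logPartition ρ) (θ i) := fun i =>
    (hμ i).trans (mean_expFam hreg (hθ i))
  rw [hμ' a, hμ' star] at ha hd
  have hpos : ∀ η ∈ natParamSpace ρ, 0 < deriv (deriv (logPartition ρ)) η := fun η hη =>
    deriv_deriv_logPartition_pos hreg (hθ a) (hθ star) ha.ne hη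
  have hmono := strictMonoOn_deriv_logPartition hreg hpos
  have hlt : θ a < θ star := (hmono.lt_iff_lt (hθ a) (hθ star)).1 ha
  obtain ⟨v, hgreatest, hbound, η, hη, hvη⟩ :=
    isGreatest_variance hreg hmono (hθ a) (hθ star) hlt.le
  have hv : 0 < v := hvη ▸ hpos η hη
  have hd' : d = logLik ρ (θ a) (θ star) (deriv (logPartition ρ) (θ a)) := by
    rw [hd, klMean_eq_logLik hreg (mem_image_of_mem _ (hθ a)) (mem_image_of_mem _ (hθ star)),
      natParam_deriv_logPartition hmono (hθ a), natParam_deriv_logPartition hmono (hθ star),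
      ENNReal.toReal_ofReal (logLik_mean_nonneg hreg (hθ a) (hθ star))]
  have hd0 : 0 < d := hd' ▸ logLik_mean_pos hreg hmono (hθ a) (hθ star) hlt
  refine ⟨θ a - θ star, v, ?_, ?_, fun T hT => ?_⟩
  · rw [hμ' a, hμ' star]
    exact hasDerivAt_klMean_left hreg hpos (hθ a) (hθ star)
  · rw [hμ' a, hμ' star]
    exact hgreatest
  · refine (halg.integral_pulls_le hreg hmono hθ hrun hlt hv hbound hd' hd0 hT).trans
      (le_of_eq ?_)
    -- Merging the two square roots of the target reproduces `2π V F`, with `V = v d'² / d²` and `F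
    -- = f(T) / d`.
    rw [explorationRate_of_three_le hT, mul_assoc 2 √_ √_, ← Real.sqrt_mul (by positivity)]
    have h : 2 * Real.pi * (v * (θ a - θ star) ^ 2 / d ^ 2) *
        ((Real.log T + 3 * Real.log (Real.log T)) / d) =
        2 * Real.pi * v * (θ a - θ star) ^ 2 / d ^ 3 *
          (Real.log T + 3 * Real.log (Real.log T)) := by
      field_simp
    rw [h]
    field_simp
    ring
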